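/- Let $n\ge 0$ and let $G\le \mathrm{GL}(n,\mathbb{C})$ be an algebraic $\mathbb{Q}$-group, i.e. a subgroup that is the set of common zeros in $\mathrm{GL}(n,\mathbb{C})$ of a set of polynomials in the matrix entries with coefficients in $\mathbb{Q}$. Assume that $G$ is solvable. For $R=\mathbb{Z},\mathbb{Q}$ put $G_R = G\cap \mathrm{GL}(n,R)$. A subgroup $H\le G_{\mathbb{Q}}$ is called an arithmetic subgroup of $G$ if it is commensurable with $G_{\mathbb{Z}}$, i.e. $H\cap G_{\mathbb{Z}}$ has finite index in both $H$ and $G_{\mathbb{Z}}$. A subgroup $H\le\mathrm{GL}(n,\mathbb{Q})$ is called integral if $g^{-1}Hg\le \mathrm{GL}(n,\mathbb{Z})$ for some $g\in\mathrm{GL}(n,\mathbb{Q})$. A group $K$ has finite torsion-free rank if it has a finite subnormal series each of whose factors is periodic or infinite cyclic; the number of infinite cyclic factors in such a series, which does not depend on the series, is the Hirsch number $\mathrm{h}(K)$; put $\mathrm{h}(K)=\infty$ if there is no such series. Then $\mathrm{h}(G_{\mathbb{Z}})<\infty$, and the following hold. 1. If $H$ is a finitely generated subgroup of $G_{\mathbb{Q}}$,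 then $\mathrm{h}(H)<\infty$, and $H$ is an arithmetic subgroup of $G$ if and only if $H$ is integral and $\mathrm{h}(H)=\mathrm{h}(G_{\mathbb{Z}})$. 2. In particular, a subgroup $H\le G_{\mathbb{Z}}$ is an arithmetic subgroup of $G$ if and only if $\mathrm{h}(H)=\mathrm{h}(G_{\mathbb{Z}})$. -/

import Mathlib

namespace ArithSolv

open Matrix

/-- `K_R = K ∩ GL(n, R)` for a subgroup `K` of `GL(n, ℂ)`. It is used with `R = ℚ` and `R = ℤ`,
where the structure map `R → ℂ` is the inclusion. -/
def points {n : ℕ} (R : Type*) [CommRing R] [Algebra R ℂ] (K : Subgroup (GL (Fin n) ℂ)) :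
    Subgroup (GL (Fin n) ℂ) :=
  K ⊓ (GeneralLinearGroup.map (n := Fin n) (algebraMap R ℂ)).range

/-- `G ≤ GL(n, ℂ)` is an algebraic `ℚ`-group: it is the set of common zeros in `GL(n, ℂ)` of a set
of polynomials in the matrix entries with rational coefficients. -/
def IsAlgebraicQGroup {n : ℕ} (G : Subgroup (GL (Fin n) ℂ)) : Prop :=
  ∃ S : Set (MvPolynomial (Fin n × Fin n) ℚ), ∀ g : GL (Fin n) ℂ,
    g ∈ G ↔ ∀ p ∈ S,
      MvPolynomial.aeval (fun ij : Fin n × Fin n => (g : Matrix (Fin n) (Fin n) ℂ) ij.1 ij.2) p = 0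

/-- `H` is an arithmetic subgroup of `G`: `H` is contained in `G_ℚ` and is commensurable with
`G_ℤ`, i.e. `H ∩ G_ℤ` has finite index both in `H` and in `G_ℤ`. -/
def IsArithmeticSubgroup {n : ℕ} (H G : Subgroup (GL (Fin n) ℂ)) : Prop :=
  H ≤ points ℚ G ∧ Subgroup.Commensurable H (points ℤ G)

/-- `H` is integral: `H ≤ GL(n, ℚ)` and some conjugate `g⁻¹ H g` with `g ∈ GL(n, ℚ)` is contained
in `GL(n, ℤ)`. -/
def IsIntegralSubgroup {n : ℕ} (H : Subgroup (GL (Fin n) ℂ)) : Prop :=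
  H ≤ points ℚ ⊤ ∧
    ∃ g ∈ points ℚ (⊤ : Subgroup (GL (Fin n) ℂ)), ∀ h ∈ H, g⁻¹ * h * g ∈ points ℤ ⊤

/-- `HasHirschSeries K r`: the group `K` has a finite subnormal series from `1` to `K` each of
whose factors is periodic or infinite cyclic, with exactly `r` steps counted as infinite cyclic
factors. By the Schreier refinement theorem `r` does not depend on the series. -/
inductive HasHirschSeries {Γ : Type*} [Group Γ] : Subgroup Γ → ℕ → Prop
  | bot : HasHirschSeries ⊥ 0
  | periodic (A B : Subgroup Γ) (r : ℕ) (hAB : A ≤ B) (hn : (A.subgroupOf B).Normal)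
      (ht : IsMulTorsion (B ⧸ A.subgroupOf B)) (hA : HasHirschSeries A r) :
      HasHirschSeries B r
  | infiniteCyclic (A B : Subgroup Γ) (r : ℕ) (hAB : A ≤ B) (hn : (A.subgroupOf B).Normal)
      (hc : IsCyclic (B ⧸ A.subgroupOf B)) (hi : Infinite (B ⧸ A.subgroupOf B))
      (hA : HasHirschSeries A r) :
      HasHirschSeries B (r + 1)

/-- The Hirsch number (torsion-free rank) of `K`: the number of infinite cyclic factors in a finite
subnormal series of `K` with periodic or infinite cyclic factors; it is `⊤` exactly when there is
no such series, i.e. when `K` does not have finite torsion-free rank. -/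
noncomputable def hirschNumber {Γ : Type*} [Group Γ] (K : Subgroup Γ) : ℕ∞ :=
  ⨅ (r : ℕ) (_ : HasHirschSeries K r), (r : ℕ∞)

end ArithSolv

/-! The group `G_ℤ` is solvable and satisfies the maximal condition on subgroups. In such a group a
subgroup of full Hirsch number has finite index (`relIndex_ne_zero_of_hirschNumber_eq`). If `H` is
integral, then `H ∩ GL(n, ℤ)` has finite index in `H`, since conjugation by a rational matrix keeps
a deep enough congruence subgroup integral. So `H ∩ G_ℤ` has the Hirsch number of `H`, and if this
is that of `G_ℤ`, the intersection also has finite index in `G_ℤ`. Conversely, commensurable groups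
have equal Hirsch numbers, and an arithmetic group preserves the lattice spanned by its translates
of `ℤ^n`, which makes it integral.

The maximal condition for `G_ℤ` and the finite rank of finitely generated subgroups of `G_ℚ` come
from one Lie–Kolchin argument, run for any class of groups closed under subgroups and extensions
(`ExtensionClass.of_isSolvable`). Subalgebras of `End V` stand in for Zariski closed sets: a
subgroup of finite index is connected in this sense, and a connected solvable group has a common
eigenvector. Splitting off eigenvectors leaves images of characters and additive groups of finitely
generated `R`-modules, `R = ℤ` or `ℚ`. Over `ℤ` the characters have finitely generated images by
Dirichlet's unit theorem; over `ℚ` because the group is finitely generated. -/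

namespace ArithSolv

/-! ### Hirsch series and Hirsch numbers -/

section Hirsch

variable {Γ Γ' : Type*} [Group Γ] [Group Γ']

theorem HasHirschSeries.of_torsion_hom {A B : Subgroup Γ} {r : ℕ} (hAB : A ≤ B) (φ : B →* Γ')
    (hφ : φ.ker = A.subgroupOf B) (ht : IsMulTorsion φ.range) (hA : HasHirschSeries A r) :
    HasHirschSeries B r := by
  have hn : (A.subgroupOf B).Normal := hφ ▸ inferInstance
  refine .periodic A B r hAB hn ?_ hA
  let e := (QuotientGroup.quotientMulEquivOfEq hφ.symm).trans
    (QuotientGroup.quotientKerEquivRange φ)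
  exact IsMulTorsion.of_surjective (f := e.symm.toMonoidHom) e.symm.surjective ht

/-- A cyclic factor may be finite, and then it counts as a periodic step; hence only an upper bound
on the length. -/
theorem HasHirschSeries.of_cyclic_hom {A B : Subgroup Γ} {r : ℕ} (hAB : A ≤ B) (φ : B →* Γ')
    (hφ : φ.ker = A.subgroupOf B) (hc : IsCyclic φ.range) (hA : HasHirschSeries A r) :
    ∃ s ≤ r + 1, HasHirschSeries B s := by
  have hn : (A.subgroupOf B).Normal := hφ ▸ inferInstance
  rcases finite_or_infinite φ.range with hf | hf
  · exact ⟨r, by omega, hA.of_torsion_hom hAB φ hφ (isMulTorsion_of_finite)⟩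
  · let e := (QuotientGroup.quotientMulEquivOfEq hφ.symm).trans
      (QuotientGroup.quotientKerEquivRange φ)
    exact ⟨r + 1, le_rfl, .infiniteCyclic A B r hAB hn
      (isCyclic_of_injective e.toMonoidHom e.injective) (Infinite.of_injective _ e.symm.injective) hA⟩

/-- The projection to a quotient `B / A`, pulled back along a homomorphism `f : K → Γ'`. -/
noncomputable def pullbackQuotient {K : Subgroup Γ} (f : K →* Γ') (A B : Subgroup Γ')
    [(A.subgroupOf B).Normal] : (B.comap f).map K.subtype →* B ⧸ A.subgroupOf B :=
  (QuotientGroup.mk' (A.subgroupOf B)).comp ((f.subgroupComap B).comp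
    ((B.comap f).equivMapOfInjective K.subtype K.subtype_injective).symm.toMonoidHom)

theorem ker_pullbackQuotient {K : Subgroup Γ} (f : K →* Γ') (A B : Subgroup Γ')
    [(A.subgroupOf B).Normal] :
    (pullbackQuotient f A B).ker =
      ((A.comap f).map K.subtype).subgroupOf ((B.comap f).map K.subtype) := by
  ext x
  obtain ⟨y, rfl⟩ := ((B.comap f).equivMapOfInjective K.subtype K.subtype_injective).surjective x
  simp only [pullbackQuotient, MonoidHom.mem_ker, MonoidHom.comp_apply, Subgroup.mem_subgroupOf]
  simp only [MulEquiv.toMonoidHom_eq_coe, MonoidHom.coe_coe, MulEquiv.symm_apply_apply,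
    QuotientGroup.mk'_apply, QuotientGroup.eq_one_iff, Subgroup.mem_subgroupOf,
    Subgroup.coe_equivMapOfInjective_apply]
  rw [Subgroup.mem_map_iff_mem K.subtype_injective]
  rfl

/-- A Hirsch series of the kernel of `f : K → Γ'` and one of `B ≤ Γ'` combine to a Hirsch series
of the preimage of `B`. -/
theorem HasHirschSeries.comap_hom {K : Subgroup Γ} (f : K →* Γ') {k b : ℕ}
    (h0 : HasHirschSeries (f.ker.map K.subtype) k) {B : Subgroup Γ'} (hB : HasHirschSeries B b) :
    ∃ s ≤ k + b, HasHirschSeries ((B.comap f).map K.subtype) s := by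
  induction hB with
  | bot => exact ⟨k, by omega, by rwa [MonoidHom.comap_bot]⟩
  | periodic A B r hAB hn ht hA ih =>
    obtain ⟨s, hs, h⟩ := ih
    exact ⟨s, hs, h.of_torsion_hom (Subgroup.map_mono (Subgroup.comap_mono hAB))
      (pullbackQuotient f A B) (ker_pullbackQuotient f A B) (ht.subgroup _)⟩
  | infiniteCyclic A B r hAB hn hc hi hA ih =>
    obtain ⟨s, hs, h⟩ := ih
    obtain ⟨s', hs', h'⟩ := h.of_cyclic_hom (Subgroup.map_mono (Subgroup.comap_mono hAB))
      (pullbackQuotient f A B) (ker_pullbackQuotient f A B) inferInstance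
    exact ⟨s', by omega, h'⟩

theorem HasHirschSeries.comap_injective {K : Subgroup Γ} (f : K →* Γ')
    (hf : Function.Injective f) {B : Subgroup Γ'} {b : ℕ} (hB : HasHirschSeries B b) :
    ∃ s ≤ b, HasHirschSeries ((B.comap f).map K.subtype) s := by
  obtain ⟨s, hs, h⟩ := HasHirschSeries.comap_hom f (k := 0)
    (by rw [(MonoidHom.ker_eq_bot_iff f).2 hf, Subgroup.map_bot]; exact .bot) hB
  exact ⟨s, by omega, h⟩

theorem HasHirschSeries.of_le {H K : Subgroup Γ} (hHK : H ≤ K) {r : ℕ}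
    (hK : HasHirschSeries K r) : ∃ s ≤ r, HasHirschSeries H s := by
  obtain ⟨s, hs, h⟩ := hK.comap_injective H.subtype H.subtype_injective
  refine ⟨s, hs, ?_⟩
  have : (K.comap H.subtype).map H.subtype = H := by
    ext x; simpa using fun hx => hHK hx
  rwa [this] at h

theorem HasHirschSeries.of_normal_finiteIndex {N K : Subgroup Γ} (hNK : N ≤ K)
    (hn : (N.subgroupOf K).Normal) (hfin : N.relIndex K ≠ 0) {r : ℕ} (hN : HasHirschSeries N r) :
    HasHirschSeries K r := by
  have : (N.subgroupOf K).FiniteIndex := ⟨hfin⟩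
  exact .periodic N K r hNK hn isMulTorsion_of_finite hN

/-- The series is restricted to the normal core of `H` in `K`, above which there is a single finite,
hence periodic, factor. -/
theorem HasHirschSeries.of_finiteIndex {H K : Subgroup Γ} (hHK : H ≤ K)
    (hfin : H.relIndex K ≠ 0) {r : ℕ} (hH : HasHirschSeries H r) :
    ∃ s ≤ r, HasHirschSeries K s := by
  have : (H.subgroupOf K).FiniteIndex := ⟨hfin⟩
  let N := (H.subgroupOf K).normalCore.map K.subtype
  have hNH : N ≤ H := by
    rintro _ ⟨x, hx, rfl⟩
    exact Subgroup.mem_subgroupOf.1 ((H.subgroupOf K).normalCore_le hx)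
  have hsub : N.subgroupOf K = (H.subgroupOf K).normalCore :=
    Subgroup.comap_map_eq_self_of_injective K.subtype_injective _
  obtain ⟨s, hs, h⟩ := hH.of_le hNH
  exact ⟨s, hs, h.of_normal_finiteIndex (hNH.trans hHK) (hsub ▸ inferInstance)
    (by rw [Subgroup.relIndex, hsub]; exact Subgroup.FiniteIndex.index_ne_zero)⟩

theorem hirschNumber_le {K : Subgroup Γ} {r : ℕ} (h : HasHirschSeries K r) : hirschNumber K ≤ r :=
  iInf₂_le r h

theorem exists_hirschSeries_eq {K : Subgroup Γ} (h : ∃ r, HasHirschSeries K r) :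
    ∃ r : ℕ, HasHirschSeries K r ∧ hirschNumber K = r := by
  classical
  refine ⟨Nat.find h, Nat.find_spec h, le_antisymm (hirschNumber_le (Nat.find_spec h)) ?_⟩
  exact le_iInf₂ fun r hr => by exact_mod_cast Nat.find_min' h hr

theorem hirschNumber_ne_top_iff {K : Subgroup Γ} :
    hirschNumber K ≠ ⊤ ↔ ∃ r, HasHirschSeries K r := by
  refine ⟨fun h => ?_, fun h => ?_⟩
  · by_contra! hn
    exact h (by simp [hirschNumber, hn])
  · obtain ⟨r, _, h⟩ := exists_hirschSeries_eq h
    simp [h]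

theorem hirschNumber_mono {H K : Subgroup Γ} (hHK : H ≤ K) : hirschNumber H ≤ hirschNumber K := by
  refine le_iInf₂ fun r hr => ?_
  obtain ⟨s, hs, h⟩ := hr.of_le hHK
  exact (hirschNumber_le h).trans (by exact_mod_cast hs)

/-- Since `hirschNumber` is an infimum, comparing lengths in both directions suffices; the
independence of the length from the series is never needed. -/
theorem hirschNumber_eq_of_finiteIndex {H K : Subgroup Γ} (hHK : H ≤ K)
    (hfin : H.relIndex K ≠ 0) : hirschNumber H = hirschNumber K := by
  refine le_antisymm (hirschNumber_mono hHK) (le_iInf₂ fun r hr => ?_)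
  obtain ⟨s, hs, h⟩ := hr.of_finiteIndex hHK hfin
  exact (hirschNumber_le h).trans (by exact_mod_cast hs)

theorem hirschNumber_eq_of_commensurable {H K : Subgroup Γ} (h : Subgroup.Commensurable H K) :
    hirschNumber H = hirschNumber K := by
  rw [← hirschNumber_eq_of_finiteIndex (inf_le_left : H ⊓ K ≤ H)
    (by rw [Subgroup.inf_relIndex_left]; exact h.2),
    ← hirschNumber_eq_of_finiteIndex (inf_le_right : H ⊓ K ≤ K)
    (by rw [Subgroup.inf_relIndex_right]; exact h.1)]

end Hirsch

/-! ### Groups of finite torsion-free rank -/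

section FiniteRank

/-- A group has finite torsion-free rank: it has a finite subnormal series with periodic or
infinite cyclic factors. -/
def FiniteTorsionFreeRank (G : Type*) [Group G] : Prop :=
  ∃ r, HasHirschSeries (⊤ : Subgroup G) r

variable {G G' : Type*} [Group G] [Group G']

theorem finiteTorsionFreeRank_subgroup_iff {K : Subgroup G} :
    FiniteTorsionFreeRank K ↔ ∃ r, HasHirschSeries K r := by
  constructor
  · rintro ⟨r, h⟩
    obtain ⟨s, -, hs⟩ := h.comap_injective (MonoidHom.id K) Function.injective_id
    exact ⟨s, by simpa [← MonoidHom.range_eq_map] using hs⟩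
  · rintro ⟨r, h⟩
    let f : (⊤ : Subgroup K) →* G := K.subtype.comp (Subgroup.subtype _)
    obtain ⟨s, -, hs⟩ := h.comap_injective f
      (K.subtype_injective.comp (Subgroup.subtype_injective _))
    refine ⟨s, ?_⟩
    convert hs
    ext x
    simp [f]

theorem FiniteTorsionFreeRank.extension (f : G →* G') (hker : FiniteTorsionFreeRank f.ker)
    (hrange : FiniteTorsionFreeRank f.range) : FiniteTorsionFreeRank G := by
  obtain ⟨k, hk⟩ := finiteTorsionFreeRank_subgroup_iff.1 hker
  obtain ⟨b, hb⟩ := finiteTorsionFreeRank_subgroup_iff.1 hrange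
  let g : (⊤ : Subgroup G) →* G' := f.comp (Subgroup.subtype _)
  obtain ⟨s, -, hs⟩ := HasHirschSeries.comap_hom g (k := k)
    (by convert hk; ext x; simp [g, MonoidHom.mem_ker]) hb
  refine ⟨s, ?_⟩
  convert hs
  ext x
  simp [g]

theorem FiniteTorsionFreeRank.of_injective (f : G →* G') (hf : Function.Injective f)
    (h : FiniteTorsionFreeRank G') : FiniteTorsionFreeRank G := by
  obtain ⟨r, hr⟩ := h
  obtain ⟨s, -, hs⟩ := hr.comap_injective (f.comp (Subgroup.subtype ⊤))
    (hf.comp (Subgroup.subtype_injective _))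
  refine ⟨s, ?_⟩
  convert hs
  ext x
  simp

theorem FiniteTorsionFreeRank.subgroup (h : FiniteTorsionFreeRank G) (K : Subgroup G) :
    FiniteTorsionFreeRank K :=
  h.of_injective K.subtype K.subtype_injective

theorem FiniteTorsionFreeRank.of_isMulTorsion (h : IsMulTorsion G) : FiniteTorsionFreeRank G := by
  refine ⟨0, HasHirschSeries.bot.of_torsion_hom bot_le (Subgroup.subtype (⊤ : Subgroup G)) ?_
    (h.subgroup _)⟩
  rw [Subgroup.ker_subtype, Subgroup.bot_subgroupOf]

theorem FiniteTorsionFreeRank.of_isCyclic [IsCyclic G] : FiniteTorsionFreeRank G := by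
  obtain ⟨s, -, hs⟩ := HasHirschSeries.bot.of_cyclic_hom bot_le (Subgroup.subtype (⊤ : Subgroup G))
    (by rw [Subgroup.ker_subtype, Subgroup.bot_subgroupOf]) inferInstance
  exact ⟨s, hs⟩

theorem FiniteTorsionFreeRank.pi_fin (h : FiniteTorsionFreeRank G) (m : ℕ) :
    FiniteTorsionFreeRank (Fin m → G) := by
  induction m with
  | zero => exact .of_isMulTorsion isMulTorsion_of_finite
  | succ m ih =>
    let tail : (Fin (m + 1) → G) →* (Fin m → G) :=
      { toFun := Fin.tail, map_one' := rfl, map_mul' := fun _ _ => rfl }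
    refine .extension (Pi.evalMonoidHom (fun _ : Fin (m + 1) => G) 0) ?_ (h.subgroup _)
    refine ih.of_injective (tail.comp (Subgroup.subtype _)) ?_
    rintro ⟨x, hx⟩ ⟨y, hy⟩ hxy
    ext i
    rw [MonoidHom.mem_ker, Pi.evalMonoidHom_apply] at hx hy
    refine Fin.cases (by simp [hx, hy]) (fun j => congrFun hxy j) i

/-- `ℚ` is an extension of the infinite cyclic group `ℤ` by the torsion group `ℚ/ℤ`. -/
theorem finiteTorsionFreeRank_rat : FiniteTorsionFreeRank (Multiplicative ℚ) := by
  let f : Multiplicative ℚ →* Multiplicative (ℚ ⧸ AddSubgroup.zmultiples (1 : ℚ)) :=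
    AddMonoidHom.toMultiplicative (QuotientAddGroup.mk' _)
  refine .extension f ?_ ?_
  · have : IsCyclic f.ker := by
      have h : f.ker = Subgroup.zpowers (Multiplicative.ofAdd (1 : ℚ)) := by
        ext x
        change (QuotientAddGroup.mk' _ x.toAdd = 0) ↔ _
        rw [QuotientAddGroup.mk'_apply, QuotientAddGroup.eq_zero_iff]
        rfl
      rw [h]; infer_instance
    exact .of_isCyclic
  · refine .of_isMulTorsion ?_
    rintro ⟨_, x, rfl⟩
    refine isOfFinOrder_iff_pow_eq_one.2 ⟨x.toAdd.den, x.toAdd.den_pos, Subtype.ext ?_⟩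
    change (f x) ^ x.toAdd.den = 1
    rw [← map_pow]
    refine (QuotientAddGroup.eq_zero_iff _).2 (AddSubgroup.mem_zmultiples_iff.2 ⟨x.toAdd.num, ?_⟩)
    rw [zsmul_one, toAdd_pow, nsmul_eq_mul, Rat.den_mul_eq_num]

theorem finiteTorsionFreeRank_of_finiteDimensional (V : Type*) [AddCommGroup V] [Module ℚ V]
    [Module.Finite ℚ V] : FiniteTorsionFreeRank (Multiplicative V) := by
  let e := (Module.finBasis ℚ V).equivFun
  let f : Multiplicative V →* (Fin (Module.finrank ℚ V) → Multiplicative ℚ) :=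
    { toFun := fun v i => Multiplicative.ofAdd (e v.toAdd i)
      map_one' := by ext; simp
      map_mul' := fun x y => by ext; simp }
  refine (finiteTorsionFreeRank_rat.pi_fin _).of_injective f fun x y hxy => ?_
  exact e.injective (funext fun i => congrFun hxy i)

theorem finiteTorsionFreeRank_of_fg (C : Type*) [CommGroup C] [Group.FG C] :
    FiniteTorsionFreeRank C := by
  obtain ⟨ι, j, _, _, p, hp, e, ⟨φ⟩⟩ := CommGroup.equiv_free_prod_prod_multiplicative_zmod C
  have : ∀ i, NeZero (p i ^ e i) := fun i => ⟨pow_ne_zero _ (hp i).ne_zero⟩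
  let g := MonoidHom.fst (j → Multiplicative ℤ) ((i : ι) → Multiplicative (ZMod (p i ^ e i)))
  refine FiniteTorsionFreeRank.of_injective φ.toMonoidHom φ.injective ?_
  have h1 : FiniteTorsionFreeRank (j → Multiplicative ℤ) := by
    let σ := Fintype.equivFin j
    let h : (j → Multiplicative ℤ) →* (Fin (Fintype.card j) → Multiplicative ℤ) :=
      { toFun := fun x i => x (σ.symm i), map_one' := rfl, map_mul' := fun _ _ => rfl }
    refine (FiniteTorsionFreeRank.of_isCyclic.pi_fin _).of_injective h fun x y hxy => ?_
    ext1 i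
    simpa [h] using congrFun hxy (σ i)
  have h2 : FiniteTorsionFreeRank g.ker := by
    let s := MonoidHom.snd (j → Multiplicative ℤ) ((i : ι) → Multiplicative (ZMod (p i ^ e i)))
    refine (FiniteTorsionFreeRank.of_isMulTorsion isMulTorsion_of_finite).of_injective
      (s.comp g.ker.subtype) ?_
    rintro ⟨x, hx⟩ ⟨y, hy⟩ hxy
    exact Subtype.ext (Prod.ext ((MonoidHom.mem_ker.1 hx).trans (MonoidHom.mem_ker.1 hy).symm) hxy)
  exact .extension g h2 (h1.subgroup _)

end FiniteRank

/-! ### The maximal condition on subgroups -/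

section Noetherian

/-- Every subgroup is finitely generated. -/
def MaxCondition (G : Type*) [Group G] : Prop :=
  ∀ H : Subgroup G, H.FG

variable {G G' : Type*} [Group G] [Group G']

theorem subgroupFG_map {H : Subgroup G} (hH : H.FG) (f : G →* G') : (H.map f).FG := by
  classical
  obtain ⟨S, rfl⟩ := hH
  exact ⟨S.image f, by rw [Finset.coe_image, MonoidHom.map_closure]⟩

theorem MaxCondition.of_injective (f : G →* G') (hf : Function.Injective f)
    (h : MaxCondition G') : MaxCondition G := by
  intro H
  have h1 := h (H.map f)
  rw [← Group.fg_iff_subgroup_fg] at h1 ⊢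
  exact Group.fg_of_surjective (f := (H.equivMapOfInjective f hf).symm.toMonoidHom)
    (H.equivMapOfInjective f hf).symm.surjective

/-- Generators of `H ∩ ker f` together with lifts to `H` of generators of `f(H)` generate `H`. -/
theorem MaxCondition.extension (f : G →* G') (hker : MaxCondition f.ker)
    (hrange : MaxCondition f.range) : MaxCondition G := by
  intro H
  have h1 : (H ⊓ f.ker).FG := by
    have := subgroupFG_map (hker (H.subgroupOf f.ker)) f.ker.subtype
    rwa [Subgroup.subgroupOf_map_subtype] at this
  have h2 : (H.map f).FG := by
    have := subgroupFG_map (hrange (H.map f.rangeRestrict)) f.range.subtype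
    rwa [Subgroup.map_map, MonoidHom.subtype_comp_rangeRestrict] at this
  obtain ⟨t, ht⟩ := h2
  have hts : (t : Set G') ⊆ f '' (H : Set G) := by
    rw [← Subgroup.coe_map, ← ht]; exact Subgroup.subset_closure
  classical
  obtain ⟨S, hSH, hSt⟩ := Finset.subset_set_image_iff.1 hts
  rw [← hSt, Finset.coe_image] at ht
  have hS : Subgroup.closure (S : Set G) ≤ H := (Subgroup.closure_le H).2 hSH
  have : H = Subgroup.closure (S : Set G) ⊔ (H ⊓ f.ker) := by
    refine le_antisymm (fun x hx => ?_) (sup_le hS inf_le_left)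
    have hfx : f x ∈ (Subgroup.closure (S : Set G)).map f := by
      rw [MonoidHom.map_closure, ht]; exact Subgroup.mem_map_of_mem f hx
    obtain ⟨y, hy, hyx⟩ := hfx
    have : x = y * (y⁻¹ * x) := by group
    rw [this]
    refine Subgroup.mul_mem_sup hy ⟨H.mul_mem (H.inv_mem (hS hy)) hx, ?_⟩
    simp [hyx]
  rw [this]
  exact Subgroup.FG.sup ⟨S, rfl⟩ h1

theorem maxCondition_of_fg (C : Type*) [CommGroup C] [Group.FG C] : MaxCondition C := by
  intro H
  have h1 : Module.Finite ℤ (Additive C) := Module.Finite.iff_addGroup_fg.2 inferInstance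
  rw [Subgroup.fg_iff_add_fg]
  have := IsNoetherian.noetherian (AddSubgroup.toIntSubmodule H.toAddSubgroup)
  rw [Submodule.fg_iff_addSubgroup_fg] at this
  simpa using this

theorem maxCondition_of_finite_int (V : Type*) [AddCommGroup V] [Module.Finite ℤ V] :
    MaxCondition (Multiplicative V) := by
  have : AddGroup.FG V := Module.Finite.iff_addGroup_fg.1 inferInstance
  exact maxCondition_of_fg _

/-- Every derived subgroup has finite index: inductively it is then finitely generated, so its
abelianization is a finitely generated torsion abelian group, hence finite. The last derived
subgroup is trivial. -/
theorem finite_of_fg_isMulTorsion_of_isSolvable [Group.FG G] [hs : Group.IsSolvable G]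
    (ht : IsMulTorsion G) : Finite G := by
  have key : ∀ k, (derivedSeries G k).FiniteIndex := by
    intro k
    induction k with
    | zero => rw [derivedSeries_zero]; infer_instance
    | succ k ih =>
      set D := derivedSeries G k with hD
      have : Group.FG D := inferInstance
      have h1 : Finite (Abelianization D) := by
        have : Group.FG (Abelianization D) := QuotientGroup.fg _
        exact CommGroup.finite_of_fg_isMulTorsion _
          (IsMulTorsion.of_surjective (f := Abelianization.of) (QuotientGroup.mk_surjective)
            (ht.subgroup D))
      have h2 : (commutator D).FiniteIndex :=
        @Subgroup.finiteIndex_of_finite_quotient _ _ _ h1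
      rw [derivedSeries_succ, ← hD, ← Subgroup.map_subtype_commutator]
      refine ⟨?_⟩
      rw [Subgroup.index_map_subtype]
      exact mul_ne_zero h2.index_ne_zero ih.index_ne_zero
  obtain ⟨k, hk⟩ := hs.solvable
  have := key k
  rw [hk] at this
  exact Nat.finite_of_card_ne_zero (by simpa using this.index_ne_zero)

end Noetherian

/-! ### Full Hirsch number implies finite index -/

section Rank

variable {Γ : Type*} [Group Γ]

/-- Every coset of `H` in `HN` has a representative in `N`. -/
theorem relIndex_sup_ne_zero_of_normal {H N : Subgroup Γ} [N.Normal] (h : H.relIndex N ≠ 0) :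
    H.relIndex (H ⊔ N) ≠ 0 := by
  have : (H.subgroupOf N).FiniteIndex := ⟨h⟩
  have hsurj : Function.Surjective
      (Subgroup.quotientSubgroupOfEmbeddingOfLE H (le_sup_right : N ≤ H ⊔ N)) := by
    intro q
    obtain ⟨⟨x, hx⟩, rfl⟩ := QuotientGroup.mk_surjective q
    obtain ⟨n, hn, k, hk, rfl⟩ := Subgroup.mem_sup_of_normal_left.1 (sup_comm H N ▸ hx)
    refine ⟨QuotientGroup.mk ⟨n, hn⟩, ?_⟩
    rw [Subgroup.quotientSubgroupOfEmbeddingOfLE_apply_mk, QuotientGroup.eq,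
      Subgroup.mem_subgroupOf]
    simpa using hk
  have := Finite.of_surjective _ hsurj
  exact (Subgroup.finiteIndex_of_finite_quotient).index_ne_zero

theorem index_ne_zero_of_map {Q : Type*} [Group Q] (f : Γ →* Q) (hf : Function.Surjective f)
    {H : Subgroup Γ} (h1 : H.relIndex f.ker ≠ 0) (h2 : (H.map f).index ≠ 0) : H.index ≠ 0 := by
  rw [Subgroup.index_map, MonoidHom.range_eq_top.2 hf, Subgroup.index_top, mul_one] at h2
  rw [← Subgroup.relIndex_mul_index (le_sup_left : H ≤ H ⊔ f.ker)]
  exact mul_ne_zero (relIndex_sup_ne_zero_of_normal h1) h2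

theorem index_ne_zero_of_isCyclic [IsCyclic Γ] {H : Subgroup Γ} (hH : H ≠ ⊥) [Infinite Γ] :
    H.index ≠ 0 := by
  obtain ⟨g, hg⟩ := IsCyclic.exists_generator (α := Γ)
  obtain ⟨x, hx, hx1⟩ := H.bot_or_exists_ne_one.resolve_left hH
  obtain ⟨k, hk⟩ := Subgroup.mem_zpowers_iff.1 (hg x)
  have hk0 : k ≠ 0 := by rintro rfl; exact hx1 (by rw [← hk, zpow_zero])
  have hn : H.Normal :=
    ⟨fun y hy z => by rwa [IsCyclic.isMulCommutative.is_comm.comm z y, mul_inv_cancel_right]⟩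
  have hfin : IsOfFinOrder (QuotientGroup.mk' H g) := by
    refine isOfFinOrder_iff_zpow_eq_one.2 ⟨k, hk0, ?_⟩
    rw [← map_zpow, hk]
    exact (QuotientGroup.eq_one_iff _).2 hx
  have hf := hfin.finite_zpowers
  have htop : Subgroup.zpowers (QuotientGroup.mk' H g) = ⊤ := by
    rw [← MonoidHom.map_zpowers, (Subgroup.eq_top_iff' _).2 hg, ← MonoidHom.range_eq_map,
      QuotientGroup.range_mk']
  have : Finite (Γ ⧸ H) := by
    rw [htop] at hf
    exact Set.finite_univ_iff.1 hf
  exact (Subgroup.finiteIndex_of_finite_quotient).index_ne_zero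

/-- Induction along the series of `K`, comparing `H ∩ A` with `A`. A periodic factor is finite,
being finitely generated and solvable, and so changes neither alternative. At an infinite cyclic
factor, the image of `H` either is trivial, and `H` saves this factor, or has finite index in it. -/
theorem HasHirschSeries.relIndex_ne_zero_or_lt {K : Subgroup Γ} (hmax : MaxCondition K)
    (hsolv : Group.IsSolvable K) {r : ℕ} (hK : HasHirschSeries K r) {H : Subgroup Γ}
    (hHK : H ≤ K) : H.relIndex K ≠ 0 ∨ ∃ s < r, HasHirschSeries H s := by
  induction hK generalizing H with
  | bot => left; simp
  | periodic A B r hAB hn ht hA ih =>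
    have hmA : MaxCondition A :=
      hmax.of_injective (Subgroup.inclusion hAB) (Subgroup.inclusion_injective _)
    have hsA : Group.IsSolvable A :=
      Group.isSolvable_of_isSolvable_injective (Subgroup.inclusion_injective hAB)
    have hfg : Group.FG B := Group.fg_def.2 (hmax ⊤)
    have hfin : Finite (B ⧸ A.subgroupOf B) := finite_of_fg_isMulTorsion_of_isSolvable ht
    have hAB' : A.relIndex B ≠ 0 := (Subgroup.finiteIndex_of_finite_quotient).index_ne_zero
    rcases ih hmA hsA (H := H ⊓ A) inf_le_right with h | ⟨s, hs, h⟩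
    · left
      exact fun h0 => Subgroup.relIndex_ne_zero_trans h hAB'
        (Subgroup.relIndex_eq_zero_of_le_left inf_le_left h0)
    · right
      obtain ⟨s', hs', h'⟩ := h.of_finiteIndex (K := H) inf_le_left (by
        rw [Subgroup.inf_relIndex_left]
        exact fun h0 => hAB' (Subgroup.relIndex_eq_zero_of_le_right hHK h0))
      exact ⟨s', by omega, h'⟩
  | infiniteCyclic A B r hAB hn hc hi hA ih =>
    have hmA : MaxCondition A :=
      hmax.of_injective (Subgroup.inclusion hAB) (Subgroup.inclusion_injective _)
    have hsA : Group.IsSolvable A :=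
      Group.isSolvable_of_isSolvable_injective (Subgroup.inclusion_injective hAB)
    let φ : H →* B ⧸ A.subgroupOf B :=
      (QuotientGroup.mk' (A.subgroupOf B)).comp (Subgroup.inclusion hHK)
    have hφ : φ.ker = (H ⊓ A).subgroupOf H := by
      ext x
      simp [φ, MonoidHom.mem_ker, Subgroup.mem_subgroupOf]
    rcases ih hmA hsA (H := H ⊓ A) inf_le_right with h | ⟨s, hs, h⟩
    · by_cases hR : φ.range = ⊥
      · right
        have : H ≤ A := by
          rw [MonoidHom.range_eq_bot_iff] at hR
          have : φ.ker = ⊤ := by rw [hR]; exact MonoidHom.ker_one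
          rw [hφ, Subgroup.subgroupOf_eq_top] at this
          exact this.trans inf_le_right
        obtain ⟨s, hs, h'⟩ := hA.of_le this
        exact ⟨s, by omega, h'⟩
      · left
        refine index_ne_zero_of_map (QuotientGroup.mk' (A.subgroupOf B))
          (QuotientGroup.mk'_surjective _) ?_ ?_
        · rw [QuotientGroup.ker_mk', Subgroup.relIndex_subgroupOf hAB]
          rwa [Subgroup.inf_relIndex_right] at h
        · have h1 : (H.subgroupOf B).map (QuotientGroup.mk' (A.subgroupOf B)) = φ.range := by
            rw [MonoidHom.range_comp, Subgroup.inclusion_range]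
          rw [h1]
          exact index_ne_zero_of_isCyclic hR
    · right
      obtain ⟨s', hs', h'⟩ := h.of_cyclic_hom inf_le_left φ hφ inferInstance
      exact ⟨s', by omega, h'⟩

/-- In a solvable group with the maximal condition, a subgroup of full Hirsch number has finite
index. -/
theorem relIndex_ne_zero_of_hirschNumber_eq {H K : Subgroup Γ} (hmax : MaxCondition K)
    (hsolv : Group.IsSolvable K) (hfin : hirschNumber K ≠ ⊤) (hHK : H ≤ K)
    (h : hirschNumber H = hirschNumber K) : H.relIndex K ≠ 0 := by
  obtain ⟨r, hr, hKr⟩ := exists_hirschSeries_eq (hirschNumber_ne_top_iff.1 hfin)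
  rcases hr.relIndex_ne_zero_or_lt hmax hsolv hHK with h1 | ⟨s, hs, h1⟩
  · exact h1
  · have := hirschNumber_le h1
    rw [h, hKr, Nat.cast_le] at this
    omega

end Rank

open scoped commutatorElement

/-! ### Criteria for finite index -/

section FiniteIndexCriterion

variable {Γ : Type*} [Group Γ]

/-- The map `f` need not be a homomorphism: it only has to separate the left cosets of `S` in `H`.
-/
theorem relIndex_ne_zero_of_finite_image {S H : Subgroup Γ} {α : Type*} (f : Γ → α)
    (hf : (f '' H).Finite) (h : ∀ a ∈ H, ∀ b ∈ H, f a = f b → a⁻¹ * b ∈ S) :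
    S.relIndex H ≠ 0 := by
  have := hf.to_subtype
  let F : H ⧸ S.subgroupOf H → f '' H := fun q => ⟨f q.out, _, q.out.2, rfl⟩
  have hF : Function.Injective F := by
    intro p q hpq
    rw [← p.out_eq', ← q.out_eq']
    refine QuotientGroup.eq.2 (Subgroup.mem_subgroupOf.2 ?_)
    exact h _ p.out.2 _ q.out.2 (congrArg Subtype.val hpq)
  have := Finite.of_injective F hF
  exact (Subgroup.finiteIndex_of_finite_quotient).index_ne_zero

theorem exists_finite_transversal {N C : Subgroup Γ} (h : N.relIndex C ≠ 0) :
    ∃ T : Set Γ, T.Finite ∧ ∀ c ∈ C, ∃ t ∈ T, t⁻¹ * c ∈ N := by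
  have : (N.subgroupOf C).FiniteIndex := ⟨h⟩
  refine ⟨Set.range fun q : C ⧸ N.subgroupOf C => (q.out : Γ), Set.finite_range _,
    fun c hc => ⟨_, ⟨QuotientGroup.mk ⟨c, hc⟩, rfl⟩, ?_⟩⟩
  have := QuotientGroup.eq.1 (QuotientGroup.out_eq' (QuotientGroup.mk (s := N.subgroupOf C) ⟨c, hc⟩))
  exact Subgroup.mem_subgroupOf.1 this

end FiniteIndexCriterion

/-! ### Connectedness with respect to subalgebras of `End V` -/

section Connected

variable {k V Γ : Type*} [Field k] [AddCommGroup V] [Module k V] [Group Γ]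

/-- The subgroup of elements which act, together with their inverses, by elements of a subalgebra
of `End V`. -/
def algStab (ρ : Γ →* Module.End k V) (M : Subalgebra k (Module.End k V)) : Subgroup Γ where
  carrier := {g | ρ g ∈ M ∧ ρ g⁻¹ ∈ M}
  one_mem' := by simp [M.one_mem]
  mul_mem' := fun {a b} ha hb => by
    simp only [Set.mem_ofPred_eq, mul_inv_rev, map_mul] at *
    exact ⟨M.mul_mem ha.1 hb.1, M.mul_mem hb.2 ha.2⟩
  inv_mem' := fun {a} ha => by
    simp only [Set.mem_ofPred_eq, inv_inv] at *
    exact ha.symm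

theorem mem_algStab {ρ : Γ →* Module.End k V} {M : Subalgebra k (Module.End k V)} {g : Γ} :
    g ∈ algStab ρ M ↔ ρ g ∈ M ∧ ρ g⁻¹ ∈ M := Iff.rfl

theorem algStab_inf (ρ : Γ →* Module.End k V) (M M' : Subalgebra k (Module.End k V)) :
    algStab ρ (M ⊓ M') = algStab ρ M ⊓ algStab ρ M' := by
  ext g
  simp only [mem_algStab, Subgroup.mem_inf, Algebra.mem_inf]
  tauto

/-- A subgroup is connected if it has no proper subgroup of finite index which is cut out by a
subalgebra of `End V`. -/
def AlgConnected (ρ : Γ →* Module.End k V) (H : Subgroup Γ) : Prop :=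
  ∀ M : Subalgebra k (Module.End k V), (algStab ρ M).relIndex H ≠ 0 → H ≤ algStab ρ M

/-- Take `M₀` of least dimension. Its intersection with any other such `M` still cuts out a subgroup
of finite index, so it cannot have smaller dimension and equals `M₀`. -/
theorem exists_least_algStab [FiniteDimensional k V] (ρ : Γ →* Module.End k V) (H : Subgroup Γ) :
    ∃ M₀ : Subalgebra k (Module.End k V), (algStab ρ M₀).relIndex H ≠ 0 ∧
      ∀ M : Subalgebra k (Module.End k V), (algStab ρ M).relIndex H ≠ 0 → M₀ ≤ M := by
  classical
  have hne : ∃ d, ∃ M : Subalgebra k (Module.End k V),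
      (algStab ρ M).relIndex H ≠ 0 ∧ Module.finrank k M = d := by
    refine ⟨_, ⊤, ?_, rfl⟩
    have : algStab ρ ⊤ = ⊤ := by ext; simp [mem_algStab]
    rw [this, Subgroup.relIndex_top_left]; exact one_ne_zero
  obtain ⟨M₀, h0, hd⟩ := Nat.find_spec hne
  refine ⟨M₀, h0, fun M hM => ?_⟩
  have h1 : (algStab ρ (M₀ ⊓ M)).relIndex H ≠ 0 := by
    rw [algStab_inf]; exact Subgroup.relIndex_inf_ne_zero h0 hM
  have h2 : Module.finrank k M₀ ≤ Module.finrank k (M₀ ⊓ M : Subalgebra k (Module.End k V)) := by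
    rw [hd]; exact Nat.find_min' hne ⟨_, h1, rfl⟩
  have h3 : Subalgebra.toSubmodule (M₀ ⊓ M) = Subalgebra.toSubmodule M₀ :=
    Submodule.eq_of_le_of_finrank_le (Subalgebra.toSubmodule.monotone inf_le_left) h2
  have h4 : M₀ ⊓ M = M₀ := Subalgebra.toSubmodule_injective h3
  exact h4 ▸ inf_le_right

/-- Conjugation by `ρ g` on `End V`. -/
def conjAlgHom (ρ : Γ →* Module.End k V) (g : Γ) : Module.End k V →ₐ[k] Module.End k V :=
  AlgHom.ofLinearMap
    ((LinearMap.mulLeft k (ρ g)).comp (LinearMap.mulRight k (ρ g⁻¹)))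
    (by simp [← map_mul])
    (fun x y => by
      have h : ρ g⁻¹ * ρ g = 1 := by rw [← map_mul, inv_mul_cancel, map_one]
      simp only [LinearMap.comp_apply, LinearMap.mulLeft_apply, LinearMap.mulRight_apply]
      calc ρ g * (x * y * ρ g⁻¹) = ρ g * x * 1 * y * ρ g⁻¹ := by simp only [mul_assoc, one_mul]
        _ = _ := by rw [← h]; simp only [mul_assoc])

theorem conjAlgHom_map (ρ : Γ →* Module.End k V) (g x : Γ) :
    conjAlgHom ρ g (ρ x) = ρ (g * x * g⁻¹) := by
  simp [conjAlgHom, mul_assoc]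

/-- Every subgroup `H` has a connected subgroup of finite index, which can be chosen to be
stable under every automorphism of `H` induced by conjugation. -/
theorem exists_algConnected [FiniteDimensional k V] (ρ : Γ →* Module.End k V) (H : Subgroup Γ) :
    ∃ N ≤ H, N.relIndex H ≠ 0 ∧ AlgConnected ρ N ∧
      ∀ g, (∀ x, g * x * g⁻¹ ∈ H ↔ x ∈ H) → ∀ x ∈ N, g * x * g⁻¹ ∈ N := by
  obtain ⟨M₀, h0, hmin⟩ := exists_least_algStab ρ H
  refine ⟨H ⊓ algStab ρ M₀, inf_le_left, by rwa [Subgroup.inf_relIndex_left], fun M hM => ?_,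
    fun g hg x hx => ⟨(hg x).2 hx.1, ?_⟩⟩
  · have h1 : (algStab ρ M).relIndex H ≠ 0 := by
      refine fun h => Subgroup.relIndex_ne_zero_trans hM (L := H)
        (by rwa [Subgroup.inf_relIndex_left]) h
    have h2 := hmin M h1
    exact inf_le_right.trans fun g hg => ⟨h2 hg.1, h2 hg.2⟩
  -- Conjugation by `g` carries the finite-index condition for `M₀` to its conjugate, which
  -- therefore contains the least algebra `M₀`.
  · have h1 : algStab ρ (M₀.comap (conjAlgHom ρ g)) =
        (algStab ρ M₀).comap (MulAut.conj g).toMonoidHom := by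
      ext y
      simp only [mem_algStab, Subalgebra.mem_comap, conjAlgHom_map, Subgroup.mem_comap,
        MulEquiv.toMonoidHom_eq_coe, MonoidHom.coe_coe, MulAut.conj_apply, mul_inv_rev, inv_inv,
        mul_assoc]
    have h2 : H = H.comap (MulAut.conj g).toMonoidHom := by
      ext y; simpa using (hg y).symm
    have h3 : (algStab ρ (M₀.comap (conjAlgHom ρ g))).relIndex H ≠ 0 := by
      rw [h1, h2]; exact Subgroup.relIndex_comap_ne_zero _ h0
    have h4 := hmin _ h3
    have h5 : x ∈ algStab ρ (M₀.comap (conjAlgHom ρ g)) := ⟨h4 hx.2.1, h4 hx.2.2⟩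
    rw [h1] at h5
    simpa using h5

end Connected

/-! ### Common eigenvectors of connected solvable groups -/

section Eigenvector

variable {k V Γ : Type*} [Field k] [AddCommGroup V] [Module k V] [Group Γ]

/-- The endomorphisms which stabilize `W` and commute with `y` on `W`. -/
def commStabAlg (W : Submodule k V) (y : Module.End k V) :
    Subalgebra k (Module.End k V) where
  carrier := {x | ∀ w ∈ W, x w ∈ W ∧ x (y w) = y (x w)}
  mul_mem' := fun {a b} ha hb w hw =>
    ⟨(ha _ (hb w hw).1).1, by simp [(hb w hw).2, (ha _ (hb w hw).1).2]⟩
  add_mem' := fun {a b} ha hb w hw =>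
    ⟨W.add_mem (ha w hw).1 (hb w hw).1, by simp [(hb w hw).2, (ha w hw).2]⟩
  algebraMap_mem' := fun c w hw => by
    simp [Module.algebraMap_end_apply, W.smul_mem c hw]

theorem map_inv_apply_map (ρ : Γ →* Module.End k V) (g : Γ) (v : V) : ρ g⁻¹ (ρ g v) = v := by
  rw [← Module.End.mul_apply, ← map_mul]; simp

theorem map_ne_zero_of_ne_zero (ρ : Γ →* Module.End k V) (g : Γ) {v : V} (hv : v ≠ 0) :
    ρ g v ≠ 0 := fun h => hv (by rw [← map_inv_apply_map ρ g v, h, map_zero])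

/-- The space of simultaneous eigenvectors of `N` with eigenvalues `χ`. -/
def weightSpace (ρ : Γ →* Module.End k V) (N : Subgroup Γ) (χ : N → k) : Submodule k V where
  carrier := {w | ∀ x : N, ρ x w = χ x • w}
  add_mem' := fun ha hb x => by rw [map_add, ha x, hb x, smul_add]
  zero_mem' := fun x => by simp
  smul_mem' := fun c w hw x => by rw [map_smul, hw x, smul_comm]

/-- Eigenvectors for distinct weights are linearly independent, so there are at most `dim V`
weights. -/
theorem finite_weights [FiniteDimensional k V] (ρ : Γ →* Module.End k V) (N : Subgroup Γ) :
    {χ : N → k | ∃ w ≠ 0, w ∈ weightSpace ρ N χ}.Finite := by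
  classical
  set S := {χ : N → k | ∃ w ≠ 0, w ∈ weightSpace ρ N χ}
  choose w hw0 hw using fun χ : S => χ.2
  have hli : LinearIndependent k w := by
    rw [linearIndependent_iff']
    intro s
    induction s using Finset.induction_on with
    | empty => simp
    | insert χ₀ s hχ ih =>
      intro c hc
      have h1 : ∀ χ ∈ s, c χ = 0 := by
        intro χ hχs
        obtain ⟨x, hx⟩ : ∃ x, χ.1 x ≠ χ₀.1 x := by
          by_contra! h
          exact hχ (Subtype.ext (funext h) ▸ hχs)
        have h2 : ∑ χ ∈ s, (c χ * (χ.1 x - χ₀.1 x)) • w χ = 0 := by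
          have h3 : ρ x (∑ χ ∈ insert χ₀ s, c χ • w χ)
              - χ₀.1 x • (∑ χ ∈ insert χ₀ s, c χ • w χ) = 0 := by rw [hc]; simp
          rw [map_sum, Finset.smul_sum, ← Finset.sum_sub_distrib, Finset.sum_insert hχ] at h3
          rw [← h3, map_smul, hw χ₀ x, smul_comm, sub_self, zero_add]
          refine Finset.sum_congr rfl fun χ _ => ?_
          rw [map_smul, hw χ x, smul_smul, smul_smul, ← sub_smul]
          congr 1; ring
        exact (mul_eq_zero.1 (ih _ h2 χ hχs)).resolve_right (sub_ne_zero.2 hx)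
      rw [Finset.sum_insert hχ, Finset.sum_eq_zero fun χ h => by rw [h1 χ h, zero_smul],
        add_zero] at hc
      intro χ h
      rcases Finset.mem_insert.1 h with rfl | h
      · exact (smul_eq_zero.1 hc).resolve_right (hw0 _)
      · exact h1 χ h
  have := hli.finite
  exact S.toFinite

/-- In a minimal nonzero invariant subspace `U` of `W`, an eigenspace of any `h` is again invariant,
so it is all of `U`; hence `H` acts on `U` by scalars. -/
theorem exists_eigenvector_of_commute [IsAlgClosed k] [FiniteDimensional k V]
    (ρ : Γ →* Module.End k V) (H : Subgroup Γ) {W : Submodule k V} (hW0 : W ≠ ⊥)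
    (hW : ∀ h ∈ H, ∀ w ∈ W, ρ h w ∈ W)
    (hcomm : ∀ g ∈ H, ∀ h ∈ H, ∀ w ∈ W, ρ g (ρ h w) = ρ h (ρ g w)) :
    ∃ v : V, v ≠ 0 ∧ ∀ h ∈ H, ∃ c : k, ρ h v = c • v := by
  let S : Set (Submodule k V) := {U | U ≠ ⊥ ∧ U ≤ W ∧ ∀ h ∈ H, ∀ w ∈ U, ρ h w ∈ U}
  obtain ⟨U, ⟨hU0, hUW, hU⟩, hmin⟩ := wellFounded_lt.has_min S ⟨W, hW0, le_rfl, hW⟩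
  obtain ⟨v, hv, hv0⟩ := U.ne_bot_iff.1 hU0
  refine ⟨v, hv0, fun h hh => ?_⟩
  have : Nontrivial U := Submodule.nontrivial_iff_ne_bot.2 hU0
  obtain ⟨c, hc⟩ := Module.End.exists_eigenvalue ((ρ h).restrict (hU h hh))
  obtain ⟨u, hu, hu0⟩ := hc.exists_hasEigenvector
  let E : Submodule k V := U ⊓ (ρ h).eigenspace c
  have hE : E ∈ S := by
    refine ⟨?_, inf_le_left.trans hUW, fun g hg w hw => ⟨hU g hg w hw.1, ?_⟩⟩
    · refine E.ne_bot_iff.2 ⟨u, ⟨u.2, ?_⟩, by simpa using hu0⟩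
      rw [SetLike.mem_coe, Module.End.mem_eigenspace_iff]
      exact congrArg Subtype.val (Module.End.mem_eigenspace_iff.1 hu)
    · have h2 := Module.End.mem_eigenspace_iff.1 hw.2
      rw [SetLike.mem_coe, Module.End.mem_eigenspace_iff,
        hcomm h hh g hg w (hUW hw.1), h2, map_smul]
  have hEU : E = U := by
    by_contra hne
    exact hmin E hE (lt_of_le_of_ne inf_le_left hne)
  exact ⟨c, Module.End.mem_eigenspace_iff.1 (hEU ▸ hv : v ∈ E).2⟩

/-- Elements of the derived subgroup which act by scalars on an invariant subspace act by roots of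
unity of order dividing the dimension. -/
theorem scalar_pow_finrank_eq_one [FiniteDimensional k V]
    (ρ : Γ →* Module.End k V) (H : Subgroup Γ) {W : Submodule k V}
    (hW : ∀ h ∈ H, ∀ w ∈ W, ρ h w ∈ W) {x : Γ} (hx : x ∈ ⁅H, H⁆) {c : k}
    (hc : ∀ w ∈ W, ρ x w = c • w) : c ^ Module.finrank k W = 1 := by
  let σ : H →* Module.End k W :=
    { toFun := fun h => (ρ h).restrict (hW h h.2)
      map_one' := by ext; simp
      map_mul' := fun a b => by ext; simp }
  let δ : H →* k := (LinearMap.det : Module.End k W →* k).comp σ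
  have h1 : ⁅H, H⁆ ≤ δ.ker.map H.subtype := by
    rw [Subgroup.commutator_le]
    intro a ha b hb
    refine ⟨⁅(⟨a, ha⟩ : H), ⟨b, hb⟩⁆, ?_, rfl⟩
    have h2 : ∀ g : H, δ g * δ g⁻¹ = 1 := fun g => by rw [← map_mul, mul_inv_cancel, map_one]
    rw [SetLike.mem_coe, MonoidHom.mem_ker, commutatorElement_def, map_mul, map_mul, map_mul,
      mul_assoc, mul_mul_mul_comm, h2, h2, one_mul]
  obtain ⟨y, hy, rfl⟩ := h1 hx
  have h2 : σ y = c • 1 := by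
    ext w
    exact hc w w.2
  have h3 : δ y = 1 := hy
  rwa [MonoidHom.comp_apply, h2, LinearMap.det_smul, map_one, mul_one] at h3

/-- Passage from `N` up to `H`. As `H` permutes the finitely many weights of `N`, connectedness
makes it preserve the weight space `W` of `v`. There `N` acts by roots of unity, so `⁅H, H⁆` acts by
finitely many operators and each `h` has finitely many conjugates on `W`. By connectedness again,
`H` acts commutatively on `W`. -/
theorem exists_eigenvector_step [IsAlgClosed k] [FiniteDimensional k V]
    (ρ : Γ →* Module.End k V) {H N : Subgroup Γ} (hH : AlgConnected ρ H) (hNC : N ≤ ⁅H, H⁆)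
    (hfin : N.relIndex ⁅H, H⁆ ≠ 0) (hnorm : ∀ h ∈ H, ∀ x ∈ N, h * x * h⁻¹ ∈ N)
    {v : V} (hv0 : v ≠ 0) (hv : ∀ x ∈ N, ∃ c : k, ρ x v = c • v) :
    ∃ v : V, v ≠ 0 ∧ ∀ h ∈ H, ∃ c : k, ρ h v = c • v := by
  classical
  -- The value `0` outside `N` makes `χ` total, so that it can be evaluated at conjugates without
  -- carrying membership proofs.
  have hv' : ∀ x, ∃ c : k, x ∈ N → ρ x v = c • v := fun x => by
    by_cases hx : x ∈ N
    · obtain ⟨c, hc⟩ := hv x hx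
      exact ⟨c, fun _ => hc⟩
    · exact ⟨0, fun h => absurd h hx⟩
  choose χ hχ using hv'
  have hnorm' : ∀ h ∈ H, ∀ x ∈ N, h⁻¹ * x * h ∈ N := fun h hh x hx => by
    simpa using hnorm h⁻¹ (H.inv_mem hh) x hx
  set W := weightSpace ρ N (fun x => χ x)
  have hvW : v ∈ W := fun x => hχ x x.2
  have hW0 : W ≠ ⊥ := W.ne_bot_iff.2 ⟨v, hvW, hv0⟩
  -- the weight space is stable under `H`
  let f : Γ → (N → k) := fun a x => χ (a⁻¹ * x * a)
  have hmaps : ∀ a ∈ H, ∀ b ∈ H, f a = f b → ∀ w ∈ W, ρ (a⁻¹ * b) w ∈ W := by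
    intro a ha b hb hab w hw x
    have hx1 : a * x * a⁻¹ ∈ N := hnorm a ha x x.2
    have h1 := congrFun hab ⟨a * x * a⁻¹, hx1⟩
    have hx2 : b⁻¹ * (a * x * a⁻¹) * b ∈ N := hnorm' b hb _ hx1
    have h2 : (x : Γ) * (a⁻¹ * b) = (a⁻¹ * b) * (b⁻¹ * (a * x * a⁻¹) * b) := by group
    rw [← Module.End.mul_apply, ← map_mul, h2, map_mul, Module.End.mul_apply, hw ⟨_, hx2⟩,
      map_smul]
    simp only [f] at h1
    have h3 : a⁻¹ * (a * ↑x * a⁻¹) * a = x := by group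
    rw [h3] at h1
    simp only [h1]
  have hWH : ∀ h ∈ H, ∀ w ∈ W, ρ h w ∈ W := by
    -- With `y = 1` the commutation condition is void, and the algebra is the stabilizer of `W`.
    have h1 : (algStab ρ (commStabAlg W 1)).relIndex H ≠ 0 := by
      refine relIndex_ne_zero_of_finite_image f ((finite_weights ρ N).subset ?_) ?_
      · rintro _ ⟨a, ha, rfl⟩
        refine ⟨ρ a v, map_ne_zero_of_ne_zero ρ a hv0, fun x => ?_⟩
        have h2 : (x : Γ) * a = a * (a⁻¹ * x * a) := by group
        rw [← Module.End.mul_apply, ← map_mul, h2, map_mul, Module.End.mul_apply,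
          hχ _ (hnorm' a ha x x.2), map_smul]
      · intro a ha b hb hab
        refine ⟨fun w hw => ⟨hmaps a ha b hb hab w hw, rfl⟩, fun w hw => ⟨?_, rfl⟩⟩
        rw [mul_inv_rev, inv_inv]
        exact hmaps b hb a ha hab.symm w hw
    exact fun h hh w hw => ((hH _ h1 hh).1 w hw).1
  -- the derived subgroup acts on it by finitely many operators
  have hCfin : {φ : W →ₗ[k] V | ∃ c ∈ ⁅H, H⁆, φ = (ρ c).domRestrict W}.Finite := by
    obtain ⟨T, hT, hTC⟩ := exists_finite_transversal hfin
    have : Nontrivial W := Submodule.nontrivial_iff_ne_bot.2 hW0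
    have hroots : {c : k | c ^ Module.finrank k W = 1}.Finite := by
      refine (Polynomial.nthRoots (Module.finrank k W) (1 : k)).toFinset.finite_toSet.subset ?_
      intro c hc
      simpa [Polynomial.mem_nthRoots Module.finrank_pos] using hc
    refine (Set.Finite.image2 (fun (c : k) (t : Γ) => c • (ρ t).domRestrict W) hroots hT).subset ?_
    rintro _ ⟨c, hc, rfl⟩
    obtain ⟨t, ht, htc⟩ := hTC c hc
    refine ⟨χ (t⁻¹ * c), ?_, t, ht, ?_⟩
    · exact scalar_pow_finrank_eq_one ρ H hWH (hNC htc) fun w hw => hw ⟨_, htc⟩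
    · ext w
      have h1 : ρ (t⁻¹ * c) w = χ (t⁻¹ * c) • (w : V) := w.2 ⟨_, htc⟩
      simp only [LinearMap.smul_apply, LinearMap.domRestrict_apply]
      rw [← map_smul, ← h1, ← Module.End.mul_apply, ← map_mul]
      congr 2; group
  refine exists_eigenvector_of_commute ρ H hW0 hWH fun g hg h hh w hw => ?_
  -- Since `a * h * a⁻¹ = ⁅a, h⁆ * h`, conjugates of `h` take finitely many values on `W`; equal
  -- values mean that `a⁻¹ * b` commutes with `h` there.
  have h1 : (algStab ρ (commStabAlg W (ρ h))).relIndex H ≠ 0 := by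
    refine relIndex_ne_zero_of_finite_image (fun a => (ρ (a * h * a⁻¹)).domRestrict W)
      ((hCfin.image fun φ => φ.comp ((ρ h).restrict (hWH h hh))).subset ?_) ?_
    · rintro _ ⟨a, ha, rfl⟩
      refine ⟨_, ⟨⁅a, h⁆, Subgroup.commutator_mem_commutator ha hh, rfl⟩, ?_⟩
      ext w
      simp only [LinearMap.comp_apply, LinearMap.domRestrict_apply, LinearMap.coe_restrict_apply]
      rw [← Module.End.mul_apply, ← map_mul, commutatorElement_def, inv_mul_cancel_right]
    · have key : ∀ a ∈ H, ∀ b ∈ H,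
          (ρ (a * h * a⁻¹)).domRestrict W = (ρ (b * h * b⁻¹)).domRestrict W → ∀ w ∈ W,
          ρ (a⁻¹ * b) w ∈ W ∧ ρ (a⁻¹ * b) (ρ h w) = ρ h (ρ (a⁻¹ * b) w) := by
        intro a ha b hb hab w hw
        refine ⟨hWH _ (H.mul_mem (H.inv_mem ha) hb) w hw, ?_⟩
        have h2 := LinearMap.congr_fun hab ⟨ρ b w, hWH b hb w hw⟩
        simp only [LinearMap.domRestrict_apply] at h2
        have h3 := congrArg (ρ a⁻¹) h2
        simp only [← Module.End.mul_apply, ← map_mul] at h3 ⊢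
        rw [show a⁻¹ * b * h = a⁻¹ * (b * h * b⁻¹ * b) by group,
          show h * (a⁻¹ * b) = a⁻¹ * (a * h * a⁻¹ * b) by group]
        exact h3.symm
      intro a ha b hb hab
      refine ⟨key a ha b hb hab, ?_⟩
      rw [mul_inv_rev, inv_inv]
      exact key b hb a ha hab.symm
  exact ((hH _ h1 hg).1 w hw).2

/-- A connected solvable group has a common eigenvector. -/
theorem exists_eigenvector_of_isSolvable [IsAlgClosed k] [FiniteDimensional k V] [Nontrivial V]
    [hs : Group.IsSolvable Γ] (ρ : Γ →* Module.End k V) {H : Subgroup Γ} (hH : AlgConnected ρ H) :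
    ∃ v : V, v ≠ 0 ∧ ∀ h ∈ H, ∃ c : k, ρ h v = c • v := by
  obtain ⟨n, hn⟩ := hs.solvable
  -- Induction up from the end of the derived series, for all connected `H` at once, because `H` is
  -- replaced by a connected subgroup of finite index in `⁅H, H⁆`.
  have key : ∀ m j, j + m = n → ∀ H ≤ derivedSeries Γ j, AlgConnected ρ H →
      ∃ v : V, v ≠ 0 ∧ ∀ h ∈ H, ∃ c : k, ρ h v = c • v := by
    intro m
    induction m with
    | zero =>
      rintro j rfl H hH -
      rw [add_zero] at hn
      obtain ⟨v, hv⟩ := exists_ne (0 : V)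
      refine ⟨v, hv, fun h hh => ⟨1, ?_⟩⟩
      have : h = 1 := by simpa [hn] using hH hh
      simp [this]
    | succ m ih =>
      intro j hj H hH hc
      obtain ⟨N, hNC, hfin, hNc, hnorm⟩ := exists_algConnected ρ ⁅H, H⁆
      have hC : ⁅H, H⁆ ≤ derivedSeries Γ (j + 1) := Subgroup.commutator_mono hH hH
      obtain ⟨v, hv0, hv⟩ := ih (j + 1) (by omega) N (hNC.trans hC) hNc
      refine exists_eigenvector_step ρ hc hNC hfin (fun h hh x hx => hnorm h (fun y => ?_) x hx)
        hv0 hv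
      have hmem : ∀ h ∈ H, ∀ y ∈ ⁅H, H⁆, h * y * h⁻¹ ∈ ⁅H, H⁆ := by
        intro h hh y hy
        have h1 : h * y * h⁻¹ = ⁅h, y⁆ * y := by rw [commutatorElement_def]; group
        rw [h1]
        exact mul_mem (Subgroup.commutator_mem_commutator hh
          (Subgroup.commutator_le.2 (fun a ha b hb => by
            rw [commutatorElement_def]
            exact H.mul_mem (H.mul_mem (H.mul_mem ha hb) (H.inv_mem ha)) (H.inv_mem hb)) hy)) hy
      refine ⟨fun hy => ?_, hmem h hh y⟩
      have := hmem h⁻¹ (H.inv_mem hh) _ hy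
      simpa [mul_assoc] using this
  exact key n 0 (by omega) H (by simp) hH

end Eigenvector

/-! ### Dévissage of solvable linear groups -/

section Induction

variable {k : Type} [Field k]

theorem exists_dual_eq_one {V : Type} [AddCommGroup V] [Module k V] {v : V} (hv : v ≠ 0) :
    ∃ φ : Module.Dual k V, φ v = 1 := by
  obtain ⟨φ, hφ⟩ : ∃ φ : Module.Dual k V, φ v ≠ 0 := by
    by_contra! h
    exact hv ((Module.forall_dual_apply_eq_zero_iff k v).1 h)
  exact ⟨(φ v)⁻¹ • φ, by simp [hφ]⟩

/-- All matrix coefficients of `ρ` lie in finitely generated `R`-submodules of `k`. -/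
def CoeffBounded (R : Type) [CommRing R] [Algebra R k] {V Γ : Type} [AddCommGroup V] [Module k V]
    [Group Γ] (ρ : Γ →* Module.End k V) : Prop :=
  ∀ (v : V) (φ : Module.Dual k V), ∃ M : Submodule R k, M.FG ∧ ∀ g, φ (ρ g v) ∈ M

/-- A class of groups which is closed under extensions and under passing to subgroups, and contains
the finite groups and the additive groups of finitely generated `R`-modules. -/
structure ExtensionClass (R : Type) [CommRing R] (P : ∀ (G : Type) [Group G], Prop) : Prop where
  extension : ∀ {G G' : Type} [Group G] [Group G'] (f : G →* G'), P f.ker → P f.range → P G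
  of_injective : ∀ {G G' : Type} [Group G] [Group G'] (f : G →* G'), Function.Injective f →
    P G' → P G
  module : ∀ (X : Type) [AddCommGroup X] [Module R X] [Module.Finite R X], P (Multiplicative X)
  finite : ∀ (G : Type) [Group G] [Finite G], P G

variable {R : Type} [CommRing R] [Algebra R k] {P : ∀ (G : Type) [Group G], Prop}
  {V Γ : Type} [AddCommGroup V] [Module k V] [Group Γ]

/-- As `ρ g - 1` maps into the fixed line `k v`, the map `g ↦ ρ g - 1` is additive with kernel `ker
ρ`. Its coordinates on a basis lie in finitely generated `R`-modules. -/
theorem ExtensionClass.of_unipotent (hP : ExtensionClass R P) [FiniteDimensional k V]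
    (ρ : Γ →* Module.End k V) (hρ : CoeffBounded R ρ) {v : V} (hv0 : v ≠ 0)
    (hv : ∀ g, ρ g v = v) (hq : ∀ g w, ∃ c : k, ρ g w - w = c • v) (hker : P ρ.ker) : P Γ := by
  obtain ⟨φ, hφ⟩ := exists_dual_eq_one (k := k) hv0
  let b := Module.finBasis k V
  choose M hM hMem using fun i => hρ (b i) φ
  -- The bound concerns `φ (ρ g (b i))`; subtracting the identity requires the extra generator `φ (b
  -- i)`.
  let M' := fun i => M i ⊔ Submodule.span R {φ (b i)}
  have : ∀ i, Module.Finite R (M' i) := fun i =>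
    Module.Finite.iff_fg.2 ((hM i).sup (Submodule.fg_span_singleton _))
  have hmem : ∀ g i, φ (ρ g (b i) - b i) ∈ M' i := fun g i => by
    rw [map_sub]
    exact sub_mem (Submodule.mem_sup_left (hMem i g))
      (Submodule.mem_sup_right (Submodule.mem_span_singleton_self _))
  let f : Γ →* Multiplicative (∀ i, M' i) :=
    { toFun := fun g => Multiplicative.ofAdd fun i => ⟨φ (ρ g (b i) - b i), hmem g i⟩
      map_one' := by
        refine congrArg Multiplicative.ofAdd (funext fun i => Subtype.ext ?_)
        simp
      map_mul' := fun g h => by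
        refine congrArg Multiplicative.ofAdd (funext fun i => Subtype.ext ?_)
        obtain ⟨c, hc⟩ := hq h (b i)
        have h1 : ρ g (ρ h (b i) - b i) = ρ h (b i) - b i := by rw [hc, map_smul, hv]
        rw [map_sub] at h1
        change φ (ρ (g * h) (b i) - b i) = φ (ρ g (b i) - b i) + φ (ρ h (b i) - b i)
        rw [← map_add, map_mul, Module.End.mul_apply, ← h1]
        congr 1; abel }
  refine hP.extension f ?_ (hP.of_injective f.range.subtype f.range.subtype_injective (hP.module _))
  have hle : f.ker ≤ ρ.ker := by
    intro g hg
    refine MonoidHom.mem_ker.2 (b.ext fun i => ?_)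
    have h1 : φ (ρ g (b i) - b i) = 0 := congrArg Subtype.val
      (congrFun (congrArg Multiplicative.toAdd (MonoidHom.mem_ker.1 hg)) i)
    obtain ⟨c, hc⟩ := hq g (b i)
    rw [hc, map_smul, hφ, smul_eq_mul, mul_one] at h1
    rw [h1, zero_smul, sub_eq_zero] at hc
    exact hc
  exact hP.of_injective (Subgroup.inclusion hle) (Subgroup.inclusion_injective _) hker

/-- The representation on the quotient by an invariant subspace. -/
def quotientRep (ρ : Γ →* Module.End k V) (L : Submodule k V) (hL : ∀ g, L ≤ L.comap (ρ g)) :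
    Γ →* Module.End k (V ⧸ L) where
  toFun g := L.mapQ L (ρ g) (hL g)
  map_one' := by ext; simp
  map_mul' a b := by ext; simp

theorem quotientRep_mk (ρ : Γ →* Module.End k V) (L : Submodule k V)
    (hL : ∀ g, L ≤ L.comap (ρ g)) (g : Γ) (v : V) :
    quotientRep ρ L hL g (L.mkQ v) = L.mkQ (ρ g v) := rfl

/-- The endomorphisms which induce an element of `M` on `V / L`. -/
def liftAlg (L : Submodule k V) (M : Subalgebra k (Module.End k (V ⧸ L))) :
    Subalgebra k (Module.End k V) where
  carrier := {x | ∃ y ∈ M, ∀ w, L.mkQ (x w) = y (L.mkQ w)}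
  mul_mem' := by
    rintro a b ⟨a', ha, ha'⟩ ⟨b', hb, hb'⟩
    exact ⟨a' * b', M.mul_mem ha hb, fun w => by
      rw [Module.End.mul_apply, ha', hb', Module.End.mul_apply]⟩
  add_mem' := by
    rintro a b ⟨a', ha, ha'⟩ ⟨b', hb, hb'⟩
    exact ⟨a' + b', M.add_mem ha hb, fun w => by
      rw [LinearMap.add_apply, map_add, ha', hb', LinearMap.add_apply]⟩
  algebraMap_mem' c := ⟨algebraMap k _ c, M.algebraMap_mem c, fun w => by
    rw [Module.algebraMap_end_apply, Module.algebraMap_end_apply, map_smul]⟩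

/-- A subalgebra of `End (V ⧸ L)` pulls back to `liftAlg L M`, which cuts out the same subgroup. -/
theorem AlgConnected.quotientRep {ρ : Γ →* Module.End k V} {H : Subgroup Γ}
    (hρ : AlgConnected ρ H) (L : Submodule k V) (hL : ∀ g, L ≤ L.comap (ρ g)) :
    AlgConnected (quotientRep ρ L hL) H := by
  intro M hM
  have h1 : ∀ g, ρ g ∈ liftAlg L M ↔ ArithSolv.quotientRep ρ L hL g ∈ M := by
    refine fun g => ⟨?_, fun h => ⟨_, h, fun w => rfl⟩⟩
    rintro ⟨y, hy, hyw⟩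
    have : ArithSolv.quotientRep ρ L hL g = y := by
      ext w
      exact hyw w
    rwa [this]
  have h2 : algStab ρ (liftAlg L M) = algStab (ArithSolv.quotientRep ρ L hL) M := by
    ext g
    simp only [mem_algStab, h1]
  rw [← h2] at hM ⊢
  exact hρ _ hM

/-- A connected solvable linear group with bounded matrix coefficients belongs to a class `P` if
the images of its characters do. -/
theorem ExtensionClass.of_algConnected [IsAlgClosed k] (hP : ExtensionClass R P)
    [Group.IsSolvable Γ]
    (hχ : ∀ χ : Γ →* kˣ, (∃ M : Submodule R k, M.FG ∧ ∀ g, (χ g : k) ∈ M) → P χ.range)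
    (d : ℕ) : ∀ (V : Type) [AddCommGroup V] [Module k V] [FiniteDimensional k V]
      (ρ : Γ →* Module.End k V), Module.finrank k V = d → AlgConnected ρ ⊤ → CoeffBounded R ρ →
      P ρ.ker → P Γ := by
  induction d with
  | zero =>
    intro V _ _ _ ρ hd _ _ hker
    have := Module.finrank_zero_iff.1 hd
    have htop : (⊤ : Subgroup Γ) ≤ ρ.ker := fun g _ => by
      rw [MonoidHom.mem_ker]; ext; exact Subsingleton.elim _ _
    exact hP.of_injective ((MonoidHom.id Γ).codRestrict ρ.ker fun g => htop (Subgroup.mem_top g))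
      (fun x y hxy => congrArg Subtype.val hxy) hker
  | succ d ih =>
    intro V _ _ _ ρ hd hconn hco hker
    have : Nontrivial V := Module.nontrivial_of_finrank_pos (R := k) (by omega)
    obtain ⟨v, hv0, hv⟩ := exists_eigenvector_of_isSolvable ρ hconn
    replace hv := fun g => hv g (Subgroup.mem_top g)
    choose c hc using hv
    let χ₀ : Γ →* k :=
      { toFun := c
        map_one' := smul_left_injective k hv0 (by simp [← hc])
        map_mul' := fun a b => smul_left_injective k hv0 (by
          change c (a * b) • v = (c a * c b) • v
          rw [← hc, map_mul, Module.End.mul_apply, hc b, map_smul, hc a, smul_smul, mul_comm]) }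
    let χ : Γ →* kˣ := χ₀.toHomUnits
    have hcχ : ∀ g, (χ g : k) = c g := fun g => rfl
    obtain ⟨φ, hφ⟩ := exists_dual_eq_one (k := k) hv0
    have hχP : P χ.range := by
      obtain ⟨M, hM, hMem⟩ := hco v φ
      refine hχ χ ⟨M, hM, fun g => ?_⟩
      have := hMem g
      rwa [hc, map_smul, hφ, smul_eq_mul, mul_one] at this
    let L := Submodule.span k {v}
    have hL : ∀ g, L ≤ L.comap (ρ g) := fun g => by
      rw [Submodule.span_le, Set.singleton_subset_iff, SetLike.mem_coe, Submodule.mem_comap, hc]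
      exact Submodule.smul_mem _ _ (Submodule.mem_span_singleton_self v)
    -- The action on `V ⧸ L` need not be faithful, which is why the induction carries `P` of the
    -- kernel.
    refine ih (V ⧸ L) (quotientRep ρ L hL) ?_ (hconn.quotientRep L hL) ?_ ?_
    · have h1 := L.finrank_quotient_add_finrank
      rw [finrank_span_singleton hv0] at h1
      omega
    · intro w ψ
      obtain ⟨w, rfl⟩ := L.mkQ_surjective w
      exact hco w (ψ.comp L.mkQ)
    -- The kernel of the action on `V ⧸ L` is an extension: modulo the kernel of `χ` it embeds in
    -- the image of `χ`, and that kernel acts trivially on both `L` and `V ⧸ L`.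
    · let χ₁ := χ.comp (quotientRep ρ L hL).ker.subtype
      have hχ₁ : χ₁.range ≤ χ.range := by rintro _ ⟨g, rfl⟩; exact ⟨_, rfl⟩
      refine hP.extension χ₁ ?_ (hP.of_injective
        (Subgroup.inclusion hχ₁) (Subgroup.inclusion_injective _) hχP)
      let ι : χ₁.ker →* Γ := (quotientRep ρ L hL).ker.subtype.comp χ₁.ker.subtype
      have hι : Function.Injective ι :=
        (Subgroup.subtype_injective _).comp (Subgroup.subtype_injective _)
      refine hP.of_unipotent (ρ.comp ι) (fun w ψ => ?_) hv0 (fun g => ?_) (fun g w => ?_) ?_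
      · obtain ⟨M, hM, hMem⟩ := hco w ψ
        exact ⟨M, hM, fun g => hMem _⟩
      · have h1 : χ (ι g) = 1 := g.2
        rw [MonoidHom.comp_apply, hc, ← hcχ, h1, Units.val_one, one_smul]
      · have h1 : quotientRep ρ L hL (ι g) = 1 := g.1.2
        have h2 := LinearMap.congr_fun h1 (L.mkQ w)
        rw [quotientRep_mk, Module.End.one_apply, Submodule.mkQ_apply, Submodule.mkQ_apply,
          Submodule.Quotient.eq, Submodule.mem_span_singleton] at h2
        exact h2.imp fun c hc => hc.symm
      · let j : (ρ.comp ι).ker →* ρ.ker :=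
          (ι.comp (ρ.comp ι).ker.subtype).codRestrict ρ.ker fun g => g.2
        refine hP.of_injective j (fun x y hxy => ?_) hker
        have h1 : ι x = ι y := congrArg (fun z : ρ.ker => (z : Γ)) hxy
        exact Subtype.ext (hι h1)

theorem AlgConnected.restrict {ρ : Γ →* Module.End k V} {N : Subgroup Γ}
    (hN : AlgConnected ρ N) : AlgConnected (ρ.comp N.subtype) ⊤ := by
  intro M hM
  have h1 : algStab (ρ.comp N.subtype) M = (algStab ρ M).subgroupOf N := rfl
  rw [h1, Subgroup.relIndex_top_right] at hM
  rw [h1]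
  exact fun g _ => hN M hM g.2

theorem ExtensionClass.of_finiteIndex (hP : ExtensionClass R P) (N : Subgroup Γ) [N.FiniteIndex]
    (h : P N) : P Γ := by
  refine hP.extension (QuotientGroup.mk' N.normalCore) ?_ (hP.finite _)
  rw [QuotientGroup.ker_mk']
  exact hP.of_injective (Subgroup.inclusion N.normalCore_le) (Subgroup.inclusion_injective _) h

/-- A solvable linear group with bounded matrix coefficients belongs to a class `P` if the images
of the characters of its subgroups of finite index do. -/
theorem ExtensionClass.of_isSolvable [IsAlgClosed k] [FiniteDimensional k V]
    (hP : ExtensionClass R P) [Group.IsSolvable Γ]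
    (hχ : ∀ (N : Subgroup Γ) [N.FiniteIndex] (χ : N →* kˣ),
      (∃ M : Submodule R k, M.FG ∧ ∀ g, (χ g : k) ∈ M) → P χ.range)
    (ρ : Γ →* Module.End k V) (hρ : Function.Injective ρ) (hco : CoeffBounded R ρ) : P Γ := by
  obtain ⟨N, -, hfin, hconn, -⟩ := exists_algConnected ρ ⊤
  rw [Subgroup.relIndex_top_right] at hfin
  have : N.FiniteIndex := ⟨hfin⟩
  refine hP.of_finiteIndex N (hP.of_algConnected (hχ N) _ V (ρ.comp N.subtype) rfl hconn.restrict
    (fun v φ => ?_) ?_)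
  · obtain ⟨M, hM, hMem⟩ := hco v φ
    exact ⟨M, hM, fun g => hMem _⟩
  · have h1 : Function.Injective (ρ.comp N.subtype) := hρ.comp N.subtype_injective
    rw [(MonoidHom.ker_eq_bot_iff _).2 h1]
    exact hP.finite _

end Induction

/-! ### Unit groups in finitely generated `ℤ`-modules -/

section Units

/-- A group of units contained in a finitely generated `ℤ`-submodule of `ℂ` is finitely
generated. -/
theorem units_fg_of_le_fg (D : Subgroup ℂˣ) {M : Submodule ℤ ℂ} (hM : M.FG)
    (hD : ∀ d ∈ D, (d : ℂ) ∈ M) : Group.FG D := by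
  -- Since `D` is multiplicatively closed, the ring it generates is its additive span and stays
  -- inside `M`; hence its elements are integral and lie in a number field.
  let S : Subalgebra ℤ ℂ := Algebra.adjoin ℤ ((fun d : ℂˣ => (d : ℂ)) '' D)
  have hSM : Subalgebra.toSubmodule S ≤ M := by
    have h1 : ((fun d : ℂˣ => (d : ℂ)) '' D) = (D.toSubmonoid.map (Units.coeHom ℂ) : Set ℂ) := rfl
    rw [Algebra.adjoin_eq_span, h1, Submonoid.closure_eq, Submodule.span_le]
    rintro _ ⟨d, hd, rfl⟩
    exact hD d hd
  have hSfg : (Subalgebra.toSubmodule S).FG := hM.of_le hSM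
  have hint : ∀ x ∈ S, IsIntegral ℤ x := fun x hx => IsIntegral.of_mem_of_fg S hSfg x hx
  obtain ⟨T, hT⟩ := hSfg
  have hTS : ∀ x ∈ T, x ∈ S := fun x hx => by
    have : x ∈ Subalgebra.toSubmodule S := hT ▸ Submodule.subset_span hx
    exact this
  let E := IntermediateField.adjoin ℚ (T : Set ℂ)
  have : FiniteDimensional ℚ E :=
    IntermediateField.finiteDimensional_adjoin fun x hx => (hint x (hTS x hx)).tower_top
  have hE : NumberField E := { to_charZero := inferInstance, to_finiteDimensional := this }
  have hSE : ∀ x ∈ S, x ∈ E := by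
    intro x hx
    have h1 : x ∈ Submodule.span ℤ (T : Set ℂ) := by rw [hT]; exact hx
    have h2 : Submodule.span ℤ (T : Set ℂ) ≤ E.toSubring.toAddSubgroup.toIntSubmodule :=
      Submodule.span_le.2 fun y hy => IntermediateField.subset_adjoin ℚ _ hy
    exact h2 h1
  let f : (NumberField.RingOfIntegers E)ˣ →* ℂˣ :=
    Units.map ((algebraMap E ℂ).comp (algebraMap (NumberField.RingOfIntegers E) E)).toMonoidHom
  have hlift : ∀ x ∈ S, ∃ y : NumberField.RingOfIntegers E, ((y : E) : ℂ) = x := by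
    intro x hx
    refine ⟨⟨⟨x, hSE x hx⟩, ?_⟩, rfl⟩
    have := hint x hx
    rw [mem_integralClosure_iff]
    exact (isIntegral_algebraMap_iff (algebraMap E ℂ).injective).1 this
  have hDf : D ≤ f.range := by
    intro d hd
    have hmem : ∀ d ∈ D, (d : ℂ) ∈ S := fun d hd => Algebra.subset_adjoin ⟨d, hd, rfl⟩
    obtain ⟨y, hy⟩ := hlift _ (hmem d hd)
    obtain ⟨z, hz⟩ := hlift _ (hmem d⁻¹ (D.inv_mem hd))
    have hyz : y * z = 1 := by
      apply NumberField.RingOfIntegers.ext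
      apply Subtype.ext
      change ((y : E) : ℂ) * ((z : E) : ℂ) = 1
      rw [hy, hz, Units.mul_inv]
    refine ⟨⟨y, z, hyz, by rw [mul_comm, hyz]⟩, Units.ext hy⟩
  -- Dirichlet's unit theorem.
  have h1 : Group.FG (NumberField.RingOfIntegers E)ˣ := Group.fg_iff_monoid_fg.2 inferInstance
  have h2 : MaxCondition f.range := maxCondition_of_fg _
  have h3 : MaxCondition D :=
    h2.of_injective (Subgroup.inclusion hDf) (Subgroup.inclusion_injective _)
  exact Group.fg_def.2 (h3 ⊤)

end Units

/-! ### The two instances: `R = ℤ` and `R = ℚ` -/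

section Applications

theorem extensionClass_maxCondition : ExtensionClass ℤ (fun G [Group G] => MaxCondition G) where
  extension f := MaxCondition.extension f
  of_injective f := MaxCondition.of_injective f
  module X _ i h := by
    obtain rfl := Subsingleton.elim i (AddCommGroup.toIntModule X)
    exact maxCondition_of_finite_int X
  finite G _ _ H := by
    rw [← Group.fg_iff_subgroup_fg]; infer_instance

theorem extensionClass_finiteTorsionFreeRank :
    ExtensionClass ℚ (fun G [Group G] => FiniteTorsionFreeRank G) where
  extension f := FiniteTorsionFreeRank.extension f
  of_injective f := FiniteTorsionFreeRank.of_injective f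
  module X _ _ _ := finiteTorsionFreeRank_of_finiteDimensional X
  finite _ _ _ := FiniteTorsionFreeRank.of_isMulTorsion isMulTorsion_of_finite

variable {Γ V : Type} [Group Γ] [AddCommGroup V] [Module ℂ V] [FiniteDimensional ℂ V]

theorem maxCondition_of_isSolvable [Group.IsSolvable Γ] (ρ : Γ →* Module.End ℂ V)
    (hρ : Function.Injective ρ) (hco : CoeffBounded ℤ ρ) : MaxCondition Γ := by
  refine extensionClass_maxCondition.of_isSolvable ?_ ρ hρ hco
  rintro N _ χ ⟨M, hM, hMem⟩
  have := units_fg_of_le_fg χ.range hM (by rintro _ ⟨g, rfl⟩; exact hMem g)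
  exact maxCondition_of_fg _

/-- Subgroups of finite index in `Γ` are again finitely generated, so their characters have finitely
generated abelian images. -/
theorem finiteTorsionFreeRank_of_isSolvable [Group.IsSolvable Γ] [Group.FG Γ]
    (ρ : Γ →* Module.End ℂ V) (hρ : Function.Injective ρ) (hco : CoeffBounded ℚ ρ) :
    FiniteTorsionFreeRank Γ := by
  refine extensionClass_finiteTorsionFreeRank.of_isSolvable ?_ ρ hρ hco
  rintro N _ χ -
  exact finiteTorsionFreeRank_of_fg _

end Applications

open Matrix

/-! ### Integral and rational points -/

section Points

variable {n : ℕ} {R : Type} [CommRing R] [Algebra R ℂ]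

theorem points_mono {K K' : Subgroup (GL (Fin n) ℂ)} (h : K ≤ K') : points R K ≤ points R K' :=
  inf_le_inf_right _ h

theorem points_le (K : Subgroup (GL (Fin n) ℂ)) : points R K ≤ K := inf_le_left

theorem points_eq_inf (K : Subgroup (GL (Fin n) ℂ)) : points R K = K ⊓ points R ⊤ := by
  simp [points]

theorem points_int_le_points_rat (K : Subgroup (GL (Fin n) ℂ)) : points ℤ K ≤ points ℚ K := by
  refine inf_le_inf_left _ ?_
  rintro _ ⟨A, rfl⟩
  refine ⟨GeneralLinearGroup.map (algebraMap ℤ ℚ) A, ?_⟩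
  ext i j
  simp

theorem exists_matrix_of_mem_points {K : Subgroup (GL (Fin n) ℂ)} {g : GL (Fin n) ℂ}
    (hg : g ∈ points R K) : ∃ A : GL (Fin n) R, ∀ i j, g i j = algebraMap R ℂ (A i j) := by
  obtain ⟨-, A, rfl⟩ := hg
  exact ⟨A, fun i j => rfl⟩

theorem mem_points_int {g : GL (Fin n) ℂ} {B B' : Matrix (Fin n) (Fin n) ℤ}
    (hB : (g : Matrix (Fin n) (Fin n) ℂ) = B.map (algebraMap ℤ ℂ))
    (hB' : ((g⁻¹ : GL (Fin n) ℂ) : Matrix (Fin n) (Fin n) ℂ) = B'.map (algebraMap ℤ ℂ)) :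
    g ∈ points ℤ (⊤ : Subgroup (GL (Fin n) ℂ)) := by
  have hinj : Function.Injective
      (fun M : Matrix (Fin n) (Fin n) ℤ => M.map (algebraMap ℤ ℂ)) :=
    Matrix.map_injective (algebraMap ℤ ℂ).injective_int
  have h1 : B * B' = 1 := hinj (by
    simp only [Matrix.map_mul, ← hB, ← hB']
    rw [← Units.val_mul, mul_inv_cancel]; simp)
  have h2 : B' * B = 1 := hinj (by
    simp only [Matrix.map_mul, ← hB, ← hB']
    rw [← Units.val_mul, inv_mul_cancel]; simp)
  exact ⟨trivial, ⟨B, B', h1, h2⟩, Units.ext hB.symm⟩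

/-- The standard representation of a linear group. -/
noncomputable def stdRep (K : Subgroup (GL (Fin n) ℂ)) : K →* Module.End ℂ (Fin n → ℂ) :=
  ((Matrix.toLinAlgEquiv' (R := ℂ) (n := Fin n)).toAlgHom : _ →* _).comp
    ((Units.coeHom _).comp K.subtype)

theorem stdRep_apply (K : Subgroup (GL (Fin n) ℂ)) (g : K) (v : Fin n → ℂ) :
    stdRep K g v = ((g : GL (Fin n) ℂ) : Matrix (Fin n) (Fin n) ℂ) *ᵥ v := rfl

theorem stdRep_injective (K : Subgroup (GL (Fin n) ℂ)) : Function.Injective (stdRep K) := by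
  intro x y h
  exact Subtype.ext (Units.ext (Matrix.toLinAlgEquiv'.injective h))

/-- The coefficient is `∑ A i j * φ (e i) * v j` with `A i j` in `R`, so the products `φ (e i) * v
j` span a module that works for all `g`. -/
theorem coeffBounded_stdRep {K : Subgroup (GL (Fin n) ℂ)} (hK : K ≤ points R ⊤) :
    CoeffBounded R (stdRep K) := by
  intro v φ
  refine ⟨Submodule.span R (Set.range fun ij : Fin n × Fin n =>
    φ (Pi.single ij.1 1) * v ij.2), Submodule.fg_span (Set.finite_range _), fun g => ?_⟩
  obtain ⟨A, hA⟩ := exists_matrix_of_mem_points (hK g.2)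
  have h1 : stdRep K g v = ∑ i, (∑ j, algebraMap R ℂ (A i j) * v j) • Pi.single i (1 : ℂ) := by
    rw [stdRep_apply]
    ext i
    simp [Matrix.mulVec, dotProduct, hA, Finset.sum_apply, Pi.single_apply]
  rw [h1, map_sum]
  refine sum_mem fun i _ => ?_
  rw [map_smul, smul_eq_mul, Finset.sum_mul]
  refine sum_mem fun j _ => ?_
  rw [mul_assoc, ← Algebra.smul_def, mul_comm]
  exact Submodule.smul_mem _ _ (Submodule.subset_span ⟨(i, j), rfl⟩)

theorem maxCondition_points_int {G : Subgroup (GL (Fin n) ℂ)} (hG : Group.IsSolvable G) :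
    MaxCondition (points ℤ G) := by
  have : Group.IsSolvable (points ℤ G) :=
    Group.isSolvable_of_isSolvable_injective (Subgroup.inclusion_injective (points_le G))
  exact maxCondition_of_isSolvable _ (stdRep_injective _)
    (coeffBounded_stdRep (points_mono le_top))

theorem hirschNumber_ne_top_of_fg {G H : Subgroup (GL (Fin n) ℂ)} (hG : Group.IsSolvable G)
    (hH : H ≤ points ℚ G) (hfg : H.FG) : hirschNumber H ≠ ⊤ := by
  have : Group.IsSolvable H :=
    Group.isSolvable_of_isSolvable_injective (Subgroup.inclusion_injective (hH.trans (points_le G)))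
  have : Group.FG H := (Group.fg_iff_subgroup_fg H).2 hfg
  rw [hirschNumber_ne_top_iff, ← finiteTorsionFreeRank_subgroup_iff]
  exact finiteTorsionFreeRank_of_isSolvable _ (stdRep_injective _)
    (coeffBounded_stdRep (hH.trans (points_mono le_top)))

end Points

/-! ### Integral groups, congruence subgroups and lattices -/

section Integral

variable {n : ℕ}

/-- Allowing every multiple of `m` lets one denominator serve a matrix and its inverse together. -/
theorem exists_common_denominator (A : Matrix (Fin n) (Fin n) ℚ) :
    ∃ m : ℕ, m ≠ 0 ∧ ∀ m', m ∣ m' → ∃ P : Matrix (Fin n) (Fin n) ℤ, ∀ i j,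
      (P i j : ℚ) = m' * A i j := by
  refine ⟨∏ ij : Fin n × Fin n, (A ij.1 ij.2).den,
    Finset.prod_ne_zero_iff.2 fun ij _ => (A ij.1 ij.2).den_ne_zero, fun m' hm' => ?_⟩
  have h1 : ∀ i j, ∃ z : ℤ, (z : ℚ) = m' * A i j := fun i j => by
    obtain ⟨c, hc⟩ := (Finset.dvd_prod_of_mem (fun ij : Fin n × Fin n => (A ij.1 ij.2).den)
      (Finset.mem_univ (i, j))).trans hm'
    refine ⟨c * (A i j).num, ?_⟩
    rw [hc]
    push_cast
    rw [mul_comm ((A i j).den : ℚ), mul_assoc, Rat.den_mul_eq_num]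
  choose P hP using h1
  exact ⟨Matrix.of P, hP⟩

theorem exists_integer_multiples {g : GL (Fin n) ℂ}
    (hg : g ∈ points ℚ (⊤ : Subgroup (GL (Fin n) ℂ))) :
    ∃ (m : ℕ) (P Q : Matrix (Fin n) (Fin n) ℤ), m ≠ 0 ∧
      P.map (algebraMap ℤ ℂ) = (m : ℂ) • (g : Matrix (Fin n) (Fin n) ℂ) ∧
      Q.map (algebraMap ℤ ℂ) = (m : ℂ) • ((g⁻¹ : GL (Fin n) ℂ) : Matrix (Fin n) (Fin n) ℂ) := by
  obtain ⟨A, hA⟩ := exists_matrix_of_mem_points hg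
  obtain ⟨B, hB⟩ := exists_matrix_of_mem_points (inv_mem hg)
  obtain ⟨a, ha, hP⟩ := exists_common_denominator (A : Matrix (Fin n) (Fin n) ℚ)
  obtain ⟨b, hb, hQ⟩ := exists_common_denominator (B : Matrix (Fin n) (Fin n) ℚ)
  obtain ⟨P, hP⟩ := hP (a * b) (dvd_mul_right _ _)
  obtain ⟨Q, hQ⟩ := hQ (a * b) (dvd_mul_left _ _)
  refine ⟨a * b, P, Q, mul_ne_zero ha hb, ?_, ?_⟩
  · ext i j
    have h1 := congrArg (fun q : ℚ => (q : ℂ)) (hP i j)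
    simp only [Matrix.map_apply, Matrix.smul_apply, hA, smul_eq_mul]
    simpa using h1
  · ext i j
    have h1 := congrArg (fun q : ℚ => (q : ℂ)) (hQ i j)
    simp only [Matrix.map_apply, Matrix.smul_apply, hB, smul_eq_mul]
    simpa using h1

/-- The elements of an integral group which lie in `GL(n, ℤ)` form a subgroup of finite index,
because it contains a congruence subgroup. -/
theorem IsIntegralSubgroup.relIndex_ne_zero {H : Subgroup (GL (Fin n) ℂ)}
    (hH : IsIntegralSubgroup H) : (points ℤ (⊤ : Subgroup (GL (Fin n) ℂ))).relIndex H ≠ 0 := by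
  classical
  obtain ⟨-, g, hg, hgH⟩ := hH
  obtain ⟨m, P, Q, hm, hP, hQ⟩ := exists_integer_multiples hg
  have : NeZero (m ^ 2) := ⟨pow_ne_zero _ hm⟩
  have h1 : ∀ h, ∃ A : GL (Fin n) ℤ, h ∈ H →
      GeneralLinearGroup.map (algebraMap ℤ ℂ) A = g⁻¹ * h * g := fun h => by
    by_cases hh : h ∈ H
    · obtain ⟨-, A, hA⟩ := hgH h hh
      exact ⟨A, fun _ => hA⟩
    · exact ⟨1, fun h' => absurd h' hh⟩
  choose A hA using h1
  -- The modulus is `m ^ 2` because `g = P / m` and `g⁻¹ = Q / m`, so that `g (1 + m² F) g⁻¹ = 1 + P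
  -- F Q` is integral.
  let f : GL (Fin n) ℂ → Matrix (Fin n) (Fin n) (ZMod (m ^ 2)) := fun h =>
    (A h : Matrix (Fin n) (Fin n) ℤ).map (Int.castRingHom _)
  have key : ∀ a ∈ H, ∀ b ∈ H, f a = f b → ∃ B : Matrix (Fin n) (Fin n) ℤ,
      ((a⁻¹ * b : GL (Fin n) ℂ) : Matrix (Fin n) (Fin n) ℂ) = B.map (algebraMap ℤ ℂ) := by
    intro a ha b hb hab
    have h2 : ∀ i j, ∃ z : ℤ, A b i j = A a i j + (m ^ 2 : ℕ) * z := fun i j => by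
      have h3 : ((A a i j : ℤ) : ZMod (m ^ 2)) = ((A b i j : ℤ) : ZMod (m ^ 2)) :=
        congrFun (congrFun hab i) j
      obtain ⟨z, hz⟩ := (ZMod.intCast_eq_intCast_iff_dvd_sub _ _ _).1 h3
      exact ⟨z, by rw [← hz]; ring⟩
    choose E hE using h2
    have h3 : (A b : Matrix (Fin n) (Fin n) ℤ) =
        (A a : Matrix (Fin n) (Fin n) ℤ) + ((m ^ 2 : ℕ) : ℤ) • Matrix.of E := by
      ext i j
      rw [hE]; simp
    let F : Matrix (Fin n) (Fin n) ℤ := ((A a)⁻¹ : GL (Fin n) ℤ) * Matrix.of E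
    have h4 : (((A a)⁻¹ * A b : GL (Fin n) ℤ) : Matrix (Fin n) (Fin n) ℤ) =
        1 + ((m ^ 2 : ℕ) : ℤ) • F := by
      rw [Units.val_mul, h3, mul_add, ← Units.val_mul, inv_mul_cancel, Units.val_one,
        Matrix.mul_smul]
    have h5 : a⁻¹ * b = g * GeneralLinearGroup.map (algebraMap ℤ ℂ) ((A a)⁻¹ * A b) * g⁻¹ := by
      rw [map_mul, map_inv, hA a ha, hA b hb]
      group
    refine ⟨1 + P * F * Q, ?_⟩
    have h6 : ((GeneralLinearGroup.map (algebraMap ℤ ℂ) ((A a)⁻¹ * A b) : GL (Fin n) ℂ) :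
        Matrix (Fin n) (Fin n) ℂ) = 1 + ((m : ℂ) ^ 2) • F.map (algebraMap ℤ ℂ) := by
      have : ((GeneralLinearGroup.map (algebraMap ℤ ℂ) ((A a)⁻¹ * A b) : GL (Fin n) ℂ) :
        Matrix (Fin n) (Fin n) ℂ) = (algebraMap ℤ ℂ).mapMatrix
          (((A a)⁻¹ * A b : GL (Fin n) ℤ) : Matrix (Fin n) (Fin n) ℤ) := rfl
      rw [this, h4, map_add, map_one]
      congr 1
      ext i j
      rw [RingHom.mapMatrix_apply, Matrix.map_apply, Matrix.smul_apply, Matrix.smul_apply,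
        Matrix.map_apply, smul_eq_mul, smul_eq_mul, map_mul]
      simp
    have h7 : (1 + P * F * Q).map (algebraMap ℤ ℂ) = 1 + (P.map (algebraMap ℤ ℂ)) *
        (F.map (algebraMap ℤ ℂ)) * (Q.map (algebraMap ℤ ℂ)) := by
      change (algebraMap ℤ ℂ).mapMatrix (1 + P * F * Q) = _
      rw [map_add, map_one, map_mul, map_mul]; rfl
    rw [h7, h5, Units.val_mul, Units.val_mul, h6, hP, hQ, mul_add, mul_one, add_mul,
      ← Units.val_mul, mul_inv_cancel, Units.val_one]
    simp only [Matrix.smul_mul, Matrix.mul_smul, smul_smul]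
    congr 2; ring
  refine relIndex_ne_zero_of_finite_image f (Set.toFinite _) fun a ha b hb hab => ?_
  obtain ⟨B, hB⟩ := key a ha b hb hab
  obtain ⟨B', hB'⟩ := key b hb a ha hab.symm
  exact mem_points_int hB (by rw [_root_.mul_inv_rev, inv_inv]; exact hB')

/-- A group of rational matrices stabilizing a lattice is conjugate to a group of integral
matrices. -/
theorem exists_conj_integral_of_lattice (L : Submodule ℤ (Fin n → ℚ)) [L.IsLattice ℚ] :
    ∃ γ : GL (Fin n) ℚ, ∀ h : GL (Fin n) ℚ,
      (∀ v ∈ L, (h : Matrix (Fin n) (Fin n) ℚ) *ᵥ v ∈ L) →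
      ∃ C : Matrix (Fin n) (Fin n) ℤ,
        ((γ⁻¹ * h * γ : GL (Fin n) ℚ) : Matrix (Fin n) (Fin n) ℚ) = C.map (algebraMap ℤ ℚ) := by
  have hrank : Module.finrank ℤ L = n := by
    rw [Submodule.IsLattice.finrank_of_pi (K := ℚ), Fintype.card_fin]
  let b : Module.Basis (Fin n) ℤ L := Module.finBasisOfFinrankEq ℤ L hrank
  let b' : Module.Basis (Fin n) ℚ (Fin n → ℚ) := b.extendOfIsLattice ℚ
  have hb' : ∀ j, b' j = (b j : Fin n → ℚ) := fun j => Module.Basis.extendOfIsLattice_apply ℚ b j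
  let e := Pi.basisFun ℚ (Fin n)
  -- The columns of `γ` are a `ℤ`-basis of `L`, so `γ⁻¹ * h * γ` is the matrix of `h` in that basis.
  let γ : GL (Fin n) ℚ := ⟨e.toMatrix b', b'.toMatrix e, e.toMatrix_mul_toMatrix_flip b',
    b'.toMatrix_mul_toMatrix_flip e⟩
  have hγ : ∀ i j, γ i j = (b j : Fin n → ℚ) i := fun i j => by
    rw [← hb']; rfl
  refine ⟨γ, fun h hh => ?_⟩
  let C : Matrix (Fin n) (Fin n) ℤ := Matrix.of fun i j => b.repr ⟨_, hh (b j) (b j).2⟩ i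
  refine ⟨C, ?_⟩
  have h1 : (h : Matrix (Fin n) (Fin n) ℚ) * (γ : Matrix (Fin n) (Fin n) ℚ) =
      (γ : Matrix (Fin n) (Fin n) ℚ) * C.map (algebraMap ℤ ℚ) := by
    ext i j
    have h2 := congrArg (fun x : L => (x : Fin n → ℚ) i) (b.sum_repr ⟨_, hh (b j) (b j).2⟩)
    have h3 : ((h : Matrix (Fin n) (Fin n) ℚ) * (γ : Matrix (Fin n) (Fin n) ℚ)) i j =
        ((h : Matrix (Fin n) (Fin n) ℚ) *ᵥ (b j : Fin n → ℚ)) i := by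
      simp [Matrix.mul_apply, Matrix.mulVec, dotProduct, hγ]
    have h4 : ∑ l, C l j • (b l : Fin n → ℚ) i = ((h : Matrix (Fin n) (Fin n) ℚ) *ᵥ b j) i := by
      simp only [Submodule.coe_sum, Submodule.coe_smul, Finset.sum_apply, Pi.smul_apply] at h2
      exact h2
    rw [h3, ← h4, Matrix.mul_apply]
    refine Finset.sum_congr rfl fun l _ => ?_
    rw [hγ, Matrix.map_apply, zsmul_eq_mul, mul_comm]
    rfl
  rw [mul_assoc, Units.val_mul, Units.val_mul, h1, ← mul_assoc, ← Units.val_mul, inv_mul_cancel,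
    Units.val_one, one_mul]

/-- The `ℤ`-span `L` of all `h e_i` with `h` in `H` is `H`-stable and contains `ℤ^n`. It is finitely
generated because, up to right multiplication by integral matrices, only finitely many `h` occur. -/
theorem IsArithmeticSubgroup.isIntegralSubgroup {H G : Subgroup (GL (Fin n) ℂ)}
    (hH : IsArithmeticSubgroup H G) : IsIntegralSubgroup H := by
  obtain ⟨hHQ, hcomm⟩ := hH
  have hHQ' : H ≤ points ℚ ⊤ := hHQ.trans (points_mono le_top)
  refine ⟨hHQ', ?_⟩
  let ι : GL (Fin n) ℚ →* GL (Fin n) ℂ := GeneralLinearGroup.map (algebraMap ℚ ℂ)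
  have hfin : ((points ℤ (⊤ : Subgroup (GL (Fin n) ℂ))).comap ι).relIndex (H.comap ι) ≠ 0 := by
    refine Subgroup.relIndex_comap_ne_zero ι fun h0 => ?_
    exact hcomm.2 (Subgroup.relIndex_eq_zero_of_le_left (points_mono le_top) h0)
  obtain ⟨T, hT, hTC⟩ := exists_finite_transversal hfin
  let B : Set (Fin n → ℚ) := Set.image2 (fun (h : GL (Fin n) ℚ) (i : Fin n) =>
    (h : Matrix (Fin n) (Fin n) ℚ) *ᵥ Pi.single i 1) (H.comap ι) Set.univ
  let L : Submodule ℤ (Fin n → ℚ) := Submodule.span ℤ B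
  have hLH : ∀ h ∈ H.comap ι, ∀ v ∈ L, (h : Matrix (Fin n) (Fin n) ℚ) *ᵥ v ∈ L := by
    intro h hh v hv
    induction hv using Submodule.span_induction with
    | mem x hx =>
      obtain ⟨h', hh', i, -, rfl⟩ := hx
      refine Submodule.subset_span ⟨h * h', mul_mem hh hh', i, trivial, ?_⟩
      exact (Matrix.mulVec_mulVec _ _ _).symm
    | zero => rw [Matrix.mulVec_zero]; exact zero_mem _
    | add x y _ _ hx hy => rw [Matrix.mulVec_add]; exact add_mem hx hy
    | smul c x _ hx => rw [Matrix.mulVec_smul]; exact Submodule.smul_mem _ c hx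
  have hLfg : L.FG := by
    let B' : Set (Fin n → ℚ) := Set.image2 (fun (h : GL (Fin n) ℚ) (i : Fin n) =>
      (h : Matrix (Fin n) (Fin n) ℚ) *ᵥ Pi.single i 1) T Set.univ
    have hB' : (Submodule.span ℤ B').FG :=
      Submodule.fg_span (hT.image2 _ Set.finite_univ)
    refine hB'.of_le (Submodule.span_le.2 ?_)
    rintro _ ⟨h, hh, j, -, rfl⟩
    obtain ⟨t, ht, htc⟩ := hTC h hh
    obtain ⟨Z, hZ⟩ := exists_matrix_of_mem_points (Subgroup.mem_comap.1 htc)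
    have hZ' : ∀ i j, (t⁻¹ * h) i j = (Z i j : ℚ) := fun i j => by
      have h1 : (((t⁻¹ * h) i j : ℚ) : ℂ) = ((Z i j : ℤ) : ℂ) := hZ i j
      exact_mod_cast h1
    have h2 : (h : Matrix (Fin n) (Fin n) ℚ) *ᵥ Pi.single j 1 =
        ∑ i, Z i j • ((t : Matrix (Fin n) (Fin n) ℚ) *ᵥ Pi.single i 1) := by
      have h3 : ((t⁻¹ * h : GL (Fin n) ℚ) : Matrix (Fin n) (Fin n) ℚ) *ᵥ Pi.single j 1 =
          ∑ i, Z i j • (Pi.single i 1 : Fin n → ℚ) := by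
        ext i
        rw [Matrix.mulVec_single_one, Matrix.col_apply, hZ']
        simp [Finset.sum_apply, Pi.single_apply]
      have h4 : h = t * (t⁻¹ * h) := by group
      conv_lhs => rw [h4, Units.val_mul, ← Matrix.mulVec_mulVec, h3]
      rw [Matrix.mulVec_sum]
      exact Finset.sum_congr rfl fun i _ => Matrix.mulVec_smul _ _ _
    change (h : Matrix (Fin n) (Fin n) ℚ) *ᵥ Pi.single j 1 ∈ Submodule.span ℤ B'
    rw [h2]
    exact sum_mem fun i _ => Submodule.smul_mem _ _
      (Submodule.subset_span ⟨t, ht, i, trivial, rfl⟩)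
  have hLspan : Submodule.span ℚ (L : Set (Fin n → ℚ)) = ⊤ := by
    rw [eq_top_iff, ← (Pi.basisFun ℚ (Fin n)).span_eq, Submodule.span_le]
    rintro _ ⟨i, rfl⟩
    refine Submodule.subset_span (Submodule.subset_span ⟨1, one_mem _, i, trivial, ?_⟩)
    exact (Matrix.one_mulVec _).trans (Pi.basisFun_apply ℚ (Fin n) i).symm
  have : L.IsLattice ℚ := ⟨hLfg, hLspan⟩
  obtain ⟨γ, hγ⟩ := exists_conj_integral_of_lattice L
  refine ⟨ι γ, ⟨trivial, γ, rfl⟩, fun h hh => ?_⟩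
  obtain ⟨-, h, rfl⟩ := hHQ' hh
  obtain ⟨C, hC⟩ := hγ h (hLH h hh)
  obtain ⟨C', hC'⟩ := hγ h⁻¹ (hLH h⁻¹ ((H.comap ι).inv_mem hh))
  have hcast : ∀ (x : GL (Fin n) ℚ) (C : Matrix (Fin n) (Fin n) ℤ),
      (x : Matrix (Fin n) (Fin n) ℚ) = C.map (algebraMap ℤ ℚ) →
      ((ι x : GL (Fin n) ℂ) : Matrix (Fin n) (Fin n) ℂ) = C.map (algebraMap ℤ ℂ) := by
    intro x C hx
    ext i j
    have h1 := congrFun (congrFun hx i) j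
    change algebraMap ℚ ℂ (x i j) = _
    rw [h1]
    simp
  refine mem_points_int (B := C) (B' := C') ?_ ?_
  · rw [← hcast _ _ hC]; simp [ι]
  · rw [← hcast _ _ hC']; simp [ι, mul_assoc]

end Integral

end ArithSolv

/-! ### The main theorem -/

theorem corollary4p2 (n : ℕ) (G : Subgroup (Matrix.GeneralLinearGroup (Fin n) ℂ))
    (hG : ArithSolv.IsAlgebraicQGroup G) (hsolv : Group.IsSolvable G) :
    ArithSolv.hirschNumber (ArithSolv.points ℤ G) ≠ ⊤ ∧
    (∀ H : Subgroup (Matrix.GeneralLinearGroup (Fin n) ℂ),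
      H ≤ ArithSolv.points ℚ G → H.FG →
        ArithSolv.hirschNumber H ≠ ⊤ ∧
        (ArithSolv.IsArithmeticSubgroup H G ↔
          ArithSolv.IsIntegralSubgroup H ∧
            ArithSolv.hirschNumber H = ArithSolv.hirschNumber (ArithSolv.points ℤ G))) ∧
    (∀ H : Subgroup (Matrix.GeneralLinearGroup (Fin n) ℂ),
      H ≤ ArithSolv.points ℤ G →
        (ArithSolv.IsArithmeticSubgroup H G ↔
          ArithSolv.hirschNumber H = ArithSolv.hirschNumber (ArithSolv.points ℤ G))) := by
  have hmax := ArithSolv.maxCondition_points_int hsolv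
  have hsolvZ : Group.IsSolvable (ArithSolv.points ℤ G) :=
    Group.isSolvable_of_isSolvable_injective
      (Subgroup.inclusion_injective (ArithSolv.points_le G))
  have hfin : ArithSolv.hirschNumber (ArithSolv.points ℤ G) ≠ ⊤ :=
    ArithSolv.hirschNumber_ne_top_of_fg hsolv (ArithSolv.points_int_le_points_rat G)
      ((Group.fg_iff_subgroup_fg _).1 (Group.fg_def.2 (hmax ⊤)))
  refine ⟨hfin, fun H hH hfg => ⟨ArithSolv.hirschNumber_ne_top_of_fg hsolv hH hfg,
    fun h => ⟨h.isIntegralSubgroup, ArithSolv.hirschNumber_eq_of_commensurable h.2⟩, ?_⟩,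
    fun H hH => ⟨fun h => ArithSolv.hirschNumber_eq_of_commensurable h.2, fun h => ?_⟩⟩
  · rintro ⟨hint, hrank⟩
    -- Since `H ≤ G`, its intersections with `GL(n, ℤ)` and with `G_ℤ` coincide.
    have h1 : (ArithSolv.points ℤ G).relIndex H ≠ 0 := by
      have h2 := hint.relIndex_ne_zero
      rw [← Subgroup.inf_relIndex_right] at h2 ⊢
      rwa [ArithSolv.points_eq_inf, inf_right_comm,
        inf_eq_right.2 (hH.trans (ArithSolv.points_le G)), inf_comm]
    refine ⟨hH, ?_, h1⟩
    have h2 : ArithSolv.hirschNumber (H ⊓ ArithSolv.points ℤ G) =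
        ArithSolv.hirschNumber (ArithSolv.points ℤ G) := by
      rw [← hrank]
      exact ArithSolv.hirschNumber_eq_of_finiteIndex inf_le_left
        (by rwa [Subgroup.inf_relIndex_left])
    rw [← Subgroup.inf_relIndex_right]
    exact ArithSolv.relIndex_ne_zero_of_hirschNumber_eq hmax hsolvZ hfin inf_le_right h2
  · refine ⟨hH.trans (ArithSolv.points_int_le_points_rat G),
      ArithSolv.relIndex_ne_zero_of_hirschNumber_eq hmax hsolvZ hfin hH h, ?_⟩
    rw [Subgroup.relIndex_eq_one.2 hH]
    exact one_ne_zero
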